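/- Work in the first-order language of groups $\{\cdot,{}^{-1},1\}$. For a group $G$ and a subset $A\subseteq G$, $acl(A)$ is the set of $x\in G$ for which there is a first-order formula $\varphi(z)$ with parameters from $A$ such that $G\models\varphi(x)$ and $\varphi(G)=\{z\in G: G\models\varphi(z)\}$ is finite, and $dcl(A)$ is the set of $x\in G$ for which there is such a formula with $\varphi(G)=\{x\}$; $acl^{\exists}(A)$ and $dcl^{\exists}(A)$ are defined in the same way, with existential formulas only. Write $u^t=t^{-1}ut$. (I) Let $A_0$ be a finite set (possibly empty), let $A$ be the free group on the disjoint union $A_0\sqcup\{a,b,u\}$, let $H=A*\langle y\rangle$ be the free product of $A$ with an infinite cyclic group, let $v=aybyay^{-1}by^{-1}\in H$, and let $F$ be the HNN-extension $F=\langle H,t\mid u^t=v\rangle$; regard $A\leq H$ as subgroups of $F$. Then $F$ is a free group of rank $|A_0|+4$, and: 1. every endomorphism $f$ of $F$ that fixes $A$ pointwise is an automorphism of $F$, and either $f$ is the identity on $H$ or $f(y)=y^{-1}$; 2. $acl(A)=acl^{\exists}(A)=H$; 3. $dcl(A)=dcl^{\exists}(A)=A$, where all closures are taken in $F$. (II)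 Consequently, every free group $\Gamma$ of finite rank $n\geq 4$ can be written as an HNN-extension $\Gamma=\langle H,t\mid u^t=v\rangle$ with $H\leq\Gamma$ and $u,v\in H$, such that $H$ has a proper subgroup $A$ with $acl(A)=H$ and $dcl(A)=A$, the closures being taken in $\Gamma$. In particular $acl(A)\neq dcl(A)$ for this $A$. -/

import Mathlib

open FirstOrder

universe u v w

/-! ### Algebraic and definable closure, in an arbitrary first-order structure -/

section Closures

variable (L : FirstOrder.Language.{u, v}) {M : Type w} [L.Structure M]

/-- The algebraic closure of `A`: the elements that satisfy some formula with parameters from `A`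
that has only finitely many realizations. -/
def acl (A : Set M) : Set M :=
  {x | ∃ φ : L[[A]].Formula Unit,
    φ.Realize (fun _ => x) ∧ {z : M | φ.Realize (fun _ => z)}.Finite}

/-- The existential algebraic closure: as `acl`, with existential formulas only. -/
def aclEx (A : Set M) : Set M :=
  {x | ∃ φ : L[[A]].Formula Unit, φ.IsExistential ∧
    φ.Realize (fun _ => x) ∧ {z : M | φ.Realize (fun _ => z)}.Finite}

/-- The definable closure of `A`: the elements that are the unique realization of some formula
with parameters from `A`. -/
def dcl (A : Set M) : Set M :=
  {x | ∃ φ : L[[A]].Formula Unit, {z : M | φ.Realize (fun _ => z)} = {x}}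

/-- The existential definable closure: as `dcl`, with existential formulas only. -/
def dclEx (A : Set M) : Set M :=
  {x | ∃ φ : L[[A]].Formula Unit, φ.IsExistential ∧ {z : M | φ.Realize (fun _ => z)} = {x}}

end Closures

/-! ### The language of groups -/

/-- The function symbols of the language of groups. -/
inductive GroupFunc : ℕ → Type
  | mul : GroupFunc 2
  | inv : GroupFunc 1
  | one : GroupFunc 0

/-- The language of groups, with symbols for multiplication, inverse and identity and no relation
symbol other than equality. -/
def groupLanguage : FirstOrder.Language.{0, 0} :=
  ⟨GroupFunc, fun _ => Empty⟩

/-- Every group is a structure for the language of groups in the usual way. -/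
instance groupStructure (G : Type w) [Group G] : groupLanguage.Structure G where
  funMap {n} (f : GroupFunc n) :=
    match n, f with
    | _, .mul => fun x => x 0 * x 1
    | _, .inv => fun x => (x 0)⁻¹
    | _, .one => fun _ => 1
  RelMap {_} (r : Empty) := r.elim

/-! ### HNN-extensions along cyclic subgroups -/

section CyclicHNN

variable {G : Type w} [Group G]

/-- The isomorphism `⟨x⟩ ≃* ⟨y⟩` that sends `x` to `y`, for elements of the same order. -/
noncomputable def cyclicEquiv (x y : G) (h : orderOf x = orderOf y) :
    Subgroup.zpowers x ≃* Subgroup.zpowers y :=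
  mulEquivOfOrderOfEq
    (g := (⟨x, Subgroup.mem_zpowers x⟩ : Subgroup.zpowers x))
    (g' := (⟨y, Subgroup.mem_zpowers y⟩ : Subgroup.zpowers y))
    (by rintro ⟨_, n, rfl⟩; exact ⟨n, by ext; simp⟩)
    (by rintro ⟨_, n, rfl⟩; exact ⟨n, by ext; simp⟩)
    (by simpa using h)

theorem cyclicEquiv_apply (x y : G) (h : orderOf x = orderOf y) :
    cyclicEquiv x y h ⟨x, Subgroup.mem_zpowers x⟩ = ⟨y, Subgroup.mem_zpowers y⟩ :=
  mulEquivOfOrderOfEq_apply_gen _ _ _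

/-- The HNN-extension `⟨G, t | u ^ t = v⟩`, where `u ^ t = t⁻¹ * u * t`, for elements `u`, `v` of
the same order. -/
abbrev CyclicHNN (u v : G) (h : orderOf u = orderOf v) : Type w :=
  HNNExtension G (Subgroup.zpowers v) (Subgroup.zpowers u) (cyclicEquiv v u h.symm)

/-- The defining relation `u ^ t = v` holds. -/
theorem CyclicHNN.rel (u v : G) (h : orderOf u = orderOf v) :
    (HNNExtension.t⁻¹ * HNNExtension.of u * HNNExtension.t : CyclicHNN u v h) =
      HNNExtension.of v := by
  have h1 := HNNExtension.equiv_eq_conj (φ := cyclicEquiv v u h.symm)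
    ⟨v, Subgroup.mem_zpowers v⟩
  rw [cyclicEquiv_apply] at h1
  simp only at h1
  rw [h1]
  group

end CyclicHNN

/-! ### The groups `A = ⟨A₀, a, b, u⟩`, `H = A * ⟨y⟩` and `F = ⟨H, t | u ^ t = v⟩` -/

namespace Counterexample

/-- The free generators of `A`: the elements of `A₀` and three further letters. -/
inductive Gen (A₀ : Type u) : Type u
  | base (x : A₀) : Gen A₀
  | a : Gen A₀
  | b : Gen A₀
  | u : Gen A₀

/-- The free group on `A₀`, `a`, `b`, `u`. -/
abbrev GroupA (A₀ : Type u) : Type u := FreeGroup (Gen A₀)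

/-- The free product of `A` with the free group on one letter. -/
abbrev GroupH (A₀ : Type u) : Type u := Monoid.Coprod (GroupA A₀) (FreeGroup Unit)

variable (A₀ : Type u)

/-- The element `a` of `H`. -/
def elA : GroupH A₀ := Monoid.Coprod.inl (FreeGroup.of Gen.a)

/-- The element `b` of `H`. -/
def elB : GroupH A₀ := Monoid.Coprod.inl (FreeGroup.of Gen.b)

/-- The element `u` of `H`. -/
def elU : GroupH A₀ := Monoid.Coprod.inl (FreeGroup.of Gen.u)

/-- The element `y` of `H`. -/
def elY : GroupH A₀ := Monoid.Coprod.inr (FreeGroup.of ())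

/-- The element `v = a y b y a y⁻¹ b y⁻¹` of `H`. -/
def elV : GroupH A₀ :=
  elA A₀ * elY A₀ * elB A₀ * elY A₀ * elA A₀ * (elY A₀)⁻¹ * elB A₀ * (elY A₀)⁻¹

/-- An element with image of infinite order in an infinite cyclic group has infinite order. -/
theorem orderOf_eq_zero_of_hom {G : Type u} [Group G] (f : G →* Multiplicative ℤ) (x : G)
    (hx : f x ≠ 1) : orderOf x = 0 := by
  rw [orderOf_eq_zero_iff']
  intro n hn h
  have h1 : f x ^ n = 1 := by rw [← map_pow, h, map_one]
  have h2 : (n : ℤ) * Multiplicative.toAdd (f x) = 0 := by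
    have := congrArg Multiplicative.toAdd h1
    simpa using this
  rcases mul_eq_zero.1 h2 with h3 | h3
  · exact hn.ne' (by exact_mod_cast h3)
  · exact hx (Multiplicative.toAdd.injective (by simpa using h3))

theorem orderOf_elU : orderOf (elU A₀) = 0 := by
  apply orderOf_eq_zero_of_hom (Monoid.Coprod.lift
    (FreeGroup.lift fun g => match g with
      | Gen.u => Multiplicative.ofAdd (1 : ℤ)
      | _ => 1) 1)
  simp [elU]

theorem orderOf_elV : orderOf (elV A₀) = 0 := by
  apply orderOf_eq_zero_of_hom (Monoid.Coprod.lift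
    (FreeGroup.lift fun g => match g with
      | Gen.a => Multiplicative.ofAdd (1 : ℤ)
      | _ => 1) 1)
  simp [elV, elA, elB, elY]
  decide

theorem orderOf_elU_eq_elV : orderOf (elU A₀) = orderOf (elV A₀) :=
  (orderOf_elU A₀).trans (orderOf_elV A₀).symm

/-- The HNN-extension `F = ⟨H, t | u ^ t = v⟩`. -/
abbrev GroupF (A₀ : Type u) : Type u :=
  CyclicHNN (elU A₀) (elV A₀) (orderOf_elU_eq_elV A₀)

/-- `H` as a subgroup of `F`. -/
noncomputable def subH : Subgroup (GroupF A₀) :=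
  (HNNExtension.of : GroupH A₀ →* GroupF A₀).range

/-- `A` as a subgroup of `F`. -/
noncomputable def subA : Subgroup (GroupF A₀) :=
  ((HNNExtension.of : GroupH A₀ →* GroupF A₀).comp Monoid.Coprod.inl).range

/-- The element `y` of `F`. -/
noncomputable def y : GroupF A₀ := HNNExtension.of (elY A₀)

end Counterexample

/-! Write v(w) = a w b w a w⁻¹ b w⁻¹, so that v = v(y). An endomorphism of F over A amounts to a
pair (w, s), the images of y and t, with s⁻¹ u s = v(w). Everything rests on one fact about free
groups: v(w) is conjugate to v(y) only if w = y or w = y⁻¹ (`eq_or_eq_inv_of_isConj_twist`). To see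
it, strip from w its outer letters a, b and their inverses; up to conjugation v(w) then becomes an
explicit cyclically reduced word, which has to be a rotation of the eight-letter word v.

The relation u = t v t⁻¹ eliminates u, so F is free on A₀, a, b, y, t. As v is not a proper power,
neither is its conjugate u, so the centralizer of u is ⟨u⟩ and s is unique up to a power of u on the
left. Hence every endomorphism over A is `shift k` (t ↦ u^k t, identity on H) or `shift k` after
`flip` (y ↦ y⁻¹), and all of these are bijective.

An element of H is T(y) for a term T over A, and "∃ w s, s⁻¹ u s = v(w) ∧ z = T(w)" has at most two
solutions z; so H lies in the existential algebraic closure. Off H the orbits under `shift` are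
infinite, by the normal form in HNN-extensions (`mem_subH_of_shift_eq`), so acl(A) ⊆ H. An element
of H fixed by `flip` has no letter y (`mem_subA_of_flip_eq`), so dcl(A) ⊆ A. Part (II) takes |A₀| =
n − 4 and transports along an isomorphism. -/

namespace FreeGroup

/-! ### Cyclically reduced words and conjugacy in free groups. -/

variable {α : Type u}

theorem isCyclicallyReduced_iff_isReduced_append_self {L : List (α × Bool)} :
    IsCyclicallyReduced L ↔ IsReduced (L ++ L) := by
  unfold IsCyclicallyReduced IsReduced
  rw [List.isChain_append]
  tauto

/-- The square of the rotated word is a factor of the cube of the original one. -/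
theorem IsCyclicallyReduced.append_comm {L₁ L₂ : List (α × Bool)}
    (h : IsCyclicallyReduced (L₁ ++ L₂)) : IsCyclicallyReduced (L₂ ++ L₁) := by
  have h3 := (h.flatten_replicate 3).isReduced
  rw [isCyclicallyReduced_iff_isReduced_append_self]
  refine h3.infix ⟨L₁, L₂, ?_⟩
  simp [List.replicate_succ]

theorem isReduced_append_iff {L₁ L₂ : List (α × Bool)} :
    IsReduced (L₁ ++ L₂) ↔ IsReduced L₁ ∧ IsReduced L₂ ∧
      ∀ x ∈ L₁.getLast?, ∀ y ∈ L₂.head?, x.1 = y.1 → x.2 = y.2 :=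
  List.isChain_append

theorem mk_injOn_isReduced {L₁ L₂ : List (α × Bool)} (h₁ : IsReduced L₁) (h₂ : IsReduced L₂)
    (h : mk L₁ = mk L₂) : L₁ = L₂ := by
  classical
  have := congrArg toWord h
  rwa [toWord_mk, toWord_mk, h₁.reduce_eq, h₂.reduce_eq] at this

theorem isReduced_invRev {L : List (α × Bool)} (h : IsReduced L) : IsReduced (invRev L) := by
  classical
  rw [isReduced_iff_reduce_eq, reduce_invRev, h.reduce_eq]

/-- Conjugate cyclically reduced words are cyclic rotations of each other. -/
theorem IsCyclicallyReduced.isRotated {p L L' : List (α × Bool)} (hp : IsReduced p)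
    (hL : IsCyclicallyReduced L) (hL' : IsCyclicallyReduced L')
    (h : mk p * mk L * (mk p)⁻¹ = mk L') : L ~r L' := by
  -- If the last letter of the conjugator cancels against either end of L, conjugating by it only
  -- rotates L, and the conjugator gets shorter.
  induction p using List.reverseRecOn generalizing L with
  | nil =>
    have : L = L' := mk_injOn_isReduced hL.isReduced hL'.isReduced (by simpa [← one_eq_mk] using h)
    rw [this]
  | append_singleton p s ih =>
    have hp' : IsReduced p := (isReduced_append_iff.1 hp).1
    have hs : mk (p ++ [s]) = mk p * mk [s] := mul_mk.symm
    rcases L.eq_nil_or_concat with rfl | ⟨T, z, rfl⟩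
    · have : L' = [] := (mk_injOn_isReduced hL'.isReduced (by simp)
        (by rw [← h, ← one_eq_mk]; group))
      rw [this]
    rw [List.concat_eq_append] at *
    by_cases hz : z = s
    · subst hz
      have hrot : (T ++ [z]) ~r ([z] ++ T) := List.isRotated_append
      refine hrot.trans (ih hp' hL.append_comm ?_)
      rw [← h, hs, ← mul_mk, ← mul_mk]
      group
    by_cases hl : ∃ U, T ++ [z] = (s.1, !s.2) :: U
    · obtain ⟨U, hU⟩ := hl
      rw [hU] at hL h ⊢
      have hrot : ([(s.1, !s.2)] ++ U) ~r (U ++ [(s.1, !s.2)]) := List.isRotated_append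
      refine hrot.trans (ih hp' (IsCyclicallyReduced.append_comm (L₁ := [_]) hL) ?_)
      have e1 : (mk [(s.1, !s.2)] : FreeGroup α) = (mk [s])⁻¹ := by simp [invRev]
      rw [← h, hs, ← mul_mk, e1]
      change _ = mk p * mk [s] * mk ([(s.1, !s.2)] ++ U) * _
      rw [← mul_mk, e1]
      group
    -- Without cancellation p L p⁻¹ is already reduced, so it equals L'; but its first and last
    -- letters are inverse to each other.
    exfalso
    have hred : IsReduced (p ++ [s] ++ (T ++ [z]) ++ invRev (p ++ [s])) := by
      rw [isReduced_append_iff, isReduced_append_iff]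
      refine ⟨⟨hp, hL.isReduced, ?_⟩, isReduced_invRev hp, ?_⟩
      · intro x hx y hy hxy
        rw [List.getLast?_concat] at hx
        obtain rfl : s = x := by simpa using hx
        by_contra hne
        apply hl
        refine ⟨(T ++ [z]).tail, ?_⟩
        have : y = (s.1, !s.2) := Prod.ext hxy.symm (by
          cases h1 : s.2 <;> cases h2 : y.2 <;> simp_all)
        rw [← this]
        exact (List.cons_head?_tail hy).symm
      · intro x hx y hy hxy
        rw [← List.append_assoc, List.getLast?_concat] at hx
        obtain rfl : z = x := by simpa using hx
        obtain rfl : (s.1, !s.2) = y := by simpa [invRev] using hy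
        by_contra hne
        apply hz
        refine Prod.ext hxy ?_
        cases h1 : s.2 <;> cases h2 : z.2 <;> simp_all
    have heq : L' = p ++ [s] ++ (T ++ [z]) ++ invRev (p ++ [s]) := by
      refine mk_injOn_isReduced hL'.isReduced hred ?_
      rw [← h, inv_mk, mul_mk, mul_mk]
    obtain ⟨q, r, hqr⟩ : ∃ q r, p ++ [s] = q :: r := by
      cases p <;> simp
    have := hL'.2 (q.1, !q.2) (by
      rw [heq, hqr, invRev, List.map_cons, List.reverse_cons, ← List.append_assoc]
      exact List.getLast?_concat) q (by rw [heq, hqr]; simp) rfl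
    simp at this

theorem IsCyclicallyReduced.isRotated_of_isConj {L L' : List (α × Bool)}
    (hL : IsCyclicallyReduced L) (hL' : IsCyclicallyReduced L')
    (h : IsConj (mk L) (mk L')) : L ~r L' := by
  classical
  obtain ⟨g, hg⟩ := isConj_iff.1 h
  exact hL.isRotated (p := g.toWord) isReduced_toWord hL' (by rw [mk_toWord, hg])

end FreeGroup

/-- The element `a w b w a w⁻¹ b w⁻¹`. -/
def twist {G : Type*} [Group G] (a b w : G) : G :=
  a * w * b * w * a * w⁻¹ * b * w⁻¹

theorem map_twist {G H : Type*} [Group G] [Group H] (f : G →* H) (a b w : G) :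
    f (twist a b w) = twist (f a) (f b) (f w) := by
  simp [twist]

/-! ### Words cut into syllables by a set of letters. -/

namespace FreeGroup

variable {α : Type u}

/-- Later `p` singles out the letters a, b, and X is the part of w that remains after stripping. X
is empty exactly when all letters of L satisfy `p`. -/
theorem exists_eq_append_append (p : α → Prop) (L : List (α × Bool)) :
    ∃ P X Q : List (α × Bool), L = P ++ X ++ Q ∧ (∀ s ∈ P, p s.1) ∧ (∀ s ∈ Q, p s.1) ∧
      (∀ s ∈ X.head?, ¬ p s.1) ∧ ∀ s ∈ X.getLast?, ¬ p s.1 := by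
  induction L with
  | nil => exact ⟨[], [], [], by simp⟩
  | cons s L ih =>
    obtain ⟨P, X, Q, rfl, hP, hQ, hX, hX'⟩ := ih
    by_cases hs : p s.1
    · exact ⟨s :: P, X, Q, by simp, by simpa using ⟨hs, by simpa using hP⟩, hQ, hX, hX'⟩
    · rcases X.eq_nil_or_concat with rfl | ⟨Y, z, rfl⟩
      · refine ⟨[], [s], P ++ Q, by simp, by simp, ?_, by simpa using hs, by simpa using hs⟩
        intro t ht
        rcases List.mem_append.1 ht with h | h
        exacts [hP t h, hQ t h]
      · refine ⟨[], s :: P ++ Y.concat z, Q, by simp, by simp, hQ, by simpa using hs, ?_⟩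
        intro t ht
        apply hX' t
        rw [List.concat_eq_append, ← List.append_assoc, List.getLast?_concat] at ht
        rwa [List.concat_eq_append, List.getLast?_concat]

/-- A reduced word that begins with a letter satisfying `p` and ends with one not satisfying it. -/
structure IsBlock (p : α → Prop) (L : List (α × Bool)) : Prop where
  isReduced : IsReduced L
  head : ∃ s ∈ L.head?, p s.1
  last : ∃ s ∈ L.getLast?, ¬ p s.1

theorem isReduced_append_of_separated {p : α → Prop} {L₁ L₂ : List (α × Bool)}
    (h₁ : IsReduced L₁) (h₂ : IsReduced L₂)
    (h : ∀ x ∈ L₁.getLast?, ∀ y ∈ L₂.head?, (p x.1 ↔ ¬ p y.1)) : IsReduced (L₁ ++ L₂) := by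
  refine isReduced_append_iff.2 ⟨h₁, h₂, fun x hx y hy hxy => ?_⟩
  have := h x hx y hy
  rw [hxy] at this
  tauto

theorem IsBlock.append {p : α → Prop} {L₁ L₂ : List (α × Bool)} (h₁ : IsBlock p L₁)
    (h₂ : IsBlock p L₂) : IsBlock p (L₁ ++ L₂) := by
  obtain ⟨r₁, ⟨s, hs, ps⟩, ⟨t, ht, pt⟩⟩ := h₁
  obtain ⟨r₂, ⟨s', hs', ps'⟩, ⟨t', ht', pt'⟩⟩ := h₂
  refine ⟨isReduced_append_of_separated (p := p) r₁ r₂ ?_, ⟨s, by simp_all, ps⟩,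
    ⟨t', by simp_all, pt'⟩⟩
  intro x hx y hy
  have e₁ := Option.mem_unique ht hx
  have e₂ := Option.mem_unique hs' hy
  subst e₁ e₂
  tauto

/-- The last and the first letter are different generators, so nothing cancels cyclically. -/
theorem IsBlock.isCyclicallyReduced {p : α → Prop} {L : List (α × Bool)} (h : IsBlock p L) :
    IsCyclicallyReduced L :=
  isCyclicallyReduced_iff_isReduced_append_self.2 (h.append h).isReduced

/-- A nonempty reduced word whose first and last letters do not satisfy `p`. -/
structure IsCore (p : α → Prop) (L : List (α × Bool)) : Prop where
  isReduced : IsReduced L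
  ne_nil : L ≠ []
  head : ∀ s ∈ L.head?, ¬ p s.1
  last : ∀ s ∈ L.getLast?, ¬ p s.1

theorem IsCore.invRev {p : α → Prop} {L : List (α × Bool)} (h : IsCore p L) :
    IsCore p (FreeGroup.invRev L) := by
  refine ⟨isReduced_invRev h.isReduced, by simpa [FreeGroup.invRev] using h.ne_nil, ?_, ?_⟩
  · intro s hs
    simp only [FreeGroup.invRev, List.head?_reverse, List.getLast?_map, Option.mem_def,
      Option.map_eq_some_iff] at hs
    obtain ⟨t, ht, rfl⟩ := hs
    exact h.last t ht
  · intro s hs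
    simp only [FreeGroup.invRev, List.getLast?_reverse, List.head?_map, Option.mem_def,
      Option.map_eq_some_iff] at hs
    obtain ⟨t, ht, rfl⟩ := hs
    exact h.head t ht

theorem IsCore.isBlock {p : α → Prop} {P L : List (α × Bool)} (hP : IsReduced P)
    (hP' : P ≠ []) (hp : ∀ s ∈ P, p s.1) (h : IsCore p L) : IsBlock p (P ++ L) := by
  refine ⟨isReduced_append_of_separated (p := p) hP h.isReduced ?_, ?_, ?_⟩
  · intro x hx y hy
    have := hp x (List.mem_of_mem_getLast? hx)
    have := h.head y hy
    tauto
  · obtain ⟨s, t, rfl⟩ := List.exists_cons_of_ne_nil hP'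
    exact ⟨s, by simp, hp s (by simp)⟩
  · refine ⟨L.getLast h.ne_nil, ?_, h.last _ (List.getLast_mem_getLast? _)⟩
    rw [List.getLast?_append_of_ne_nil _ h.ne_nil]
    exact List.getLast_mem_getLast? _

/-- The reduced form of the square of a core. -/
theorem IsCore.exists_sq {p : α → Prop} {L : List (α × Bool)} (h : IsCore p L) :
    ∃ S, IsCore p S ∧ FreeGroup.mk S = FreeGroup.mk L * FreeGroup.mk L ∧
      (L.length = 1 → S.length = 2) := by
  classical
  -- With L = c r c⁻¹ and r cyclically reduced, L² reduces to c r r c⁻¹, which begins and ends with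
  -- the same letters as L.
  have hsq := reduceCyclically.reduce_flatten_replicate_succ h.isReduced 1
  have hL := reduceCyclically.conj_conjugator_reduceCyclically L
  set c := reduceCyclically.conjugator L
  set r := reduceCyclically L
  have hLL : (List.replicate (1 + 1) L).flatten = L ++ L := by simp [List.replicate_succ]
  have hrr : (List.replicate (1 + 1) r).flatten = r ++ r := by simp [List.replicate_succ]
  rw [hLL, hrr] at hsq
  refine ⟨reduce (L ++ L), ⟨?_, ?_, ?_, ?_⟩, ?_, ?_⟩
  · rw [← toWord_mk]; exact isReduced_toWord
  · rw [hsq]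
    intro h0
    apply h.ne_nil
    rw [← hL]
    simp_all
  · intro s hs
    apply h.head s
    rw [← hL]
    rw [hsq] at hs
    cases hc : c with
    | nil =>
      rw [hc] at hs
      cases hr : r <;> simp_all
    | cons x c' => rw [hc] at hs; simpa using hs
  · intro s hs
    apply h.last s
    rw [← hL]
    rw [hsq] at hs
    cases hc : c with
    | nil =>
      rw [hc] at hs
      rcases r.eq_nil_or_concat with hr | ⟨r', z, hr⟩ <;>
        simp_all [FreeGroup.invRev]
    | cons x c' =>
      rw [hc, List.getLast?_append_of_ne_nil _ (by simp [FreeGroup.invRev])] at hs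
      rwa [List.getLast?_append_of_ne_nil _ (by simp [FreeGroup.invRev])]
  · rw [reduce.self, ← mul_mk]
  · intro h1
    obtain ⟨s, rfl⟩ := List.length_eq_one_iff.1 h1
    simp [reduce]

section Alternating

variable {a b y : α}

/-- The word `a y b y a y⁻¹ b y⁻¹`. -/
def twistWord (a b y : α) : List (α × Bool) :=
  [(a, true), (y, true), (b, true), (y, true), (a, true), (y, false), (b, true), (y, false)]

theorem mk_twistWord : mk (twistWord a b y) = twist (of a) (of b) (of y) := by
  simp [twist, twistWord, of, invRev]

theorem exists_rotate_twistWord {L : List (α × Bool)} (h : L ~r twistWord a b y) :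
    ∃ n < 8, L = (twistWord a b y).rotate n := by
  obtain ⟨n, hn⟩ := h.symm
  refine ⟨n % 8, Nat.mod_lt _ (by norm_num), ?_⟩
  rw [← hn]
  exact (List.rotate_mod _ _).symm

theorem isChain_of_isRotated (hya : y ≠ a) (hyb : y ≠ b) {L : List (α × Bool)}
    (h : L ~r twistWord a b y) :
    L.IsChain fun s t => ((s.1 = a ∨ s.1 = b) ↔ ¬ (t.1 = a ∨ t.1 = b)) := by
  obtain ⟨n, hn, rfl⟩ := exists_rotate_twistWord h
  interval_cases n <;> simp [twistWord, hya, hyb]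

theorem isCyclicallyReduced_twistWord (hya : y ≠ a) (hyb : y ≠ b) :
    IsCyclicallyReduced (twistWord a b y) := by
  simp [isCyclicallyReduced_iff, IsReduced, twistWord, hya, hyb, hya.symm, hyb.symm]

/-- An alternating word that begins and ends outside `p` has odd length; only the exclusion of
length 2 is needed. -/
theorem length_core_of_isChain {p : α → Prop} {X : List (α × Bool)} (hX : IsCore p X)
    (hc : X.IsChain fun s t => (p s.1 ↔ ¬ p t.1)) : X.length = 1 ∨ 3 ≤ X.length := by
  match X, hX, hc with
  | [], hX, _ => exact absurd rfl hX.ne_nil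
  | [s], _, _ => simp
  | [s, t], hX, hc =>
    have h1 := hX.head s (by simp)
    have h2 := hX.last t (by simp)
    simp at hc
    tauto
  | s :: t :: r :: l, _, _ => simp

end Alternating

end FreeGroup

namespace FreeGroup

variable {α : Type u} {a b y : α}

/-- The lengths satisfy |P₁| + |P₂| + |P₃| + |P₄| + 4|X| = 8 with all terms positive, so every piece
is one letter. The sign pattern x, x, x⁻¹, x⁻¹ then leaves only the rotations by 0 and by 4, which
give X = y and X = y⁻¹. -/
theorem eq_of_blocks_isRotated (_hya : y ≠ a) (_hyb : y ≠ b) (hab : a ≠ b)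
    {P₁ P₂ P₃ P₄ X : List (α × Bool)}
    (h₁ : P₁ ≠ []) (h₂ : P₂ ≠ []) (h₃ : P₃ ≠ []) (h₄ : P₄ ≠ []) (hX : X ≠ [])
    (hp : ∀ s ∈ P₁, s.1 = a ∨ s.1 = b)
    (h : P₁ ++ X ++ (P₂ ++ X) ++ (P₃ ++ invRev X) ++ (P₄ ++ invRev X) ~r twistWord a b y) :
    P₁ = [(a, true)] ∧ P₂ = [(b, true)] ∧ P₃ = [(a, true)] ∧
      (X = [(y, true)] ∨ X = [(y, false)]) := by
  have hl := h.perm.length_eq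
  simp only [List.length_append, invRev_length] at hl
  have e8 : (twistWord a b y).length = 8 := rfl
  rw [e8] at hl
  have l₁ := List.length_pos_iff.2 h₁
  have l₂ := List.length_pos_iff.2 h₂
  have l₃ := List.length_pos_iff.2 h₃
  have l₄ := List.length_pos_iff.2 h₄
  have l₅ := List.length_pos_iff.2 hX
  obtain ⟨s₁, rfl⟩ := List.length_eq_one_iff.1 (by omega : P₁.length = 1)
  obtain ⟨s₂, rfl⟩ := List.length_eq_one_iff.1 (by omega : P₂.length = 1)
  obtain ⟨s₃, rfl⟩ := List.length_eq_one_iff.1 (by omega : P₃.length = 1)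
  obtain ⟨s₄, rfl⟩ := List.length_eq_one_iff.1 (by omega : P₄.length = 1)
  obtain ⟨x, rfl⟩ := List.length_eq_one_iff.1 (by omega : X.length = 1)
  have hs₁ := hp s₁ (by simp)
  obtain ⟨n, hn, hr⟩ := exists_rotate_twistWord h
  interval_cases n <;> simp [twistWord, invRev] at hr <;>
    obtain ⟨r₁, r₂, r₃, r₄, r₅, r₆, r₇, r₈⟩ := hr <;> subst r₁ <;> simp_all

/-- This handles the degenerate case where two equal cores meet and merge into X₁. If |X₂| = 1 then
|X₁| = 2, which alternation forbids; otherwise the cores X₂, X₃ have length at least 3 and the total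
exceeds 8. -/
theorem not_blocks_isRotated (hya : y ≠ a) (hyb : y ≠ b) {P₁ P₂ P₃ X₁ X₂ X₃ : List (α × Bool)}
    (h₁ : P₁ ≠ []) (h₂ : P₂ ≠ []) (h₃ : P₃ ≠ [])
    (hX₁ : IsCore (fun s => s = a ∨ s = b) X₁) (hX₂ : IsCore (fun s => s = a ∨ s = b) X₂)
    (h₂₃ : X₂.length = X₃.length) (hsq : X₂.length = 1 → X₁.length = 2) :
    ¬ (P₁ ++ X₁ ++ (P₂ ++ X₂) ++ (P₃ ++ X₃) ~r twistWord a b y) := by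
  intro h
  have hc := isChain_of_isRotated hya hyb h
  have c₁ := length_core_of_isChain hX₁ (hc.infix ⟨P₁, P₂ ++ X₂ ++ (P₃ ++ X₃), by simp⟩)
  have c₂ := length_core_of_isChain hX₂ (hc.infix ⟨P₁ ++ X₁ ++ P₂, P₃ ++ X₃, by simp⟩)
  have hl := h.perm.length_eq
  simp only [List.length_append] at hl
  have e8 : (twistWord a b y).length = 8 := rfl
  rw [e8] at hl
  have l₁ := List.length_pos_iff.2 h₁
  have l₂ := List.length_pos_iff.2 h₂
  have l₃ := List.length_pos_iff.2 h₃
  omega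

/-- The elements of the subgroup generated by `a` and `b` have words in these letters. -/
theorem forall_mem_toWord_of_mem_closure [DecidableEq α] {S : Set α} {g : FreeGroup α}
    (hg : g ∈ Subgroup.closure (of '' S)) : ∀ s ∈ g.toWord, s.1 ∈ S := by
  induction hg using Subgroup.closure_induction with
  | mem x hx =>
    obtain ⟨z, hz, rfl⟩ := hx
    simpa using hz
  | one => simp
  | mul x y _ _ hx hy =>
    intro s hs
    rcases List.mem_append.1 ((toWord_mul_sublist x y).subset hs) with h | h
    exacts [hx s h, hy s h]
  | inv x _ hx =>
    intro s hs
    rw [toWord_inv] at hs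
    simp only [invRev, List.mem_reverse, List.mem_map] at hs
    obtain ⟨t, ht, rfl⟩ := hs
    exact hx t ht

theorem mk_mem_closure {S : Set α} {L : List (α × Bool)} (h : ∀ s ∈ L, s.1 ∈ S) :
    mk L ∈ Subgroup.closure (of '' S) := by
  induction L with
  | nil => rw [← one_eq_mk]; exact one_mem _
  | cons s L ih =>
    change mk ([s] ++ L) ∈ _
    rw [← mul_mk]
    refine mul_mem ?_ (ih fun t ht => h t (by simp [ht]))
    have hs : of s.1 ∈ Subgroup.closure (of '' S) :=
      Subgroup.subset_closure ⟨_, h s (by simp), rfl⟩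
    obtain ⟨z, _ | _⟩ := s
    · have : mk [(z, false)] = (of z)⁻¹ := by simp [of, invRev]
      rw [this]
      exact inv_mem hs
    · exact hs

end FreeGroup

/-! ### Centralizers, roots and finite quotients. -/

namespace FreeGroup

theorem eq_of_commute_of {α : Type u} {s t : α} (h : Commute (of s) (of t)) : s = t := by
  classical
  by_contra hne
  have h1 : (mk [(s, true), (t, true)] : FreeGroup α) = mk [(t, true), (s, true)] := h
  have h2 := mk_injOn_isReduced (by simp [IsReduced]) (by simp [IsReduced]) h1
  simp at h2
  exact hne h2.1

/-- Commuting elements of a free group are powers of a common element. -/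
theorem exists_zpow_of_commute {G : Type u} [Group G] [IsFreeGroup G] {x y : G}
    (h : Commute x y) : ∃ (c : G) (i j : ℤ), c ^ i = x ∧ c ^ j = y := by
  let H := Subgroup.closure {x, y}
  have hcomm : ∀ g ∈ H, ∀ k ∈ H, g * k = k * g := by
    intro g hg k hk
    induction hg, hk using Subgroup.closure_induction₂ with
    | mem x y hx hy =>
      rcases hx with rfl | rfl <;> rcases hy with rfl | rfl
      exacts [rfl, h, h.symm, rfl]
    | one_left => simp
    | one_right => simp
    | mul_left x y z _ _ _ h₁ h₂ => exact Commute.mul_left h₁ h₂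
    | mul_right y z x _ _ _ h₁ h₂ => exact Commute.mul_right h₁ h₂
    | inv_left x y _ _ h => exact Commute.inv_left h
    | inv_right x y _ _ h => exact Commute.inv_right h
  -- By Nielsen–Schreier the subgroup ⟨x, y⟩ is free; being abelian it has at most one free
  -- generator, hence is cyclic.
  let e := IsFreeGroup.toFreeGroup H
  have hsub : Subsingleton (IsFreeGroup.Generators H) := by
    refine ⟨fun s t => eq_of_commute_of ?_⟩
    apply e.symm.injective
    rw [_root_.map_mul, _root_.map_mul]
    exact Subtype.ext (hcomm _ (e.symm (of s)).2 _ (e.symm (of t)).2)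
  have hcyc : IsCyclic (FreeGroup (IsFreeGroup.Generators H)) := by
    rcases isEmpty_or_nonempty (IsFreeGroup.Generators H) with hE | ⟨⟨s⟩⟩
    · infer_instance
    · have : Unique (IsFreeGroup.Generators H) := uniqueOfSubsingleton s
      infer_instance
  obtain ⟨c, hc⟩ := hcyc.exists_generator
  obtain ⟨i, hi⟩ := hc (e ⟨x, Subgroup.subset_closure (by simp)⟩)
  obtain ⟨j, hj⟩ := hc (e ⟨y, Subgroup.subset_closure (by simp)⟩)
  refine ⟨e.symm c, i, j, ?_, ?_⟩
  · have := congrArg e.symm hi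
    rw [e.symm_apply_apply] at this
    have := congrArg Subtype.val this
    simpa using this
  · have := congrArg e.symm hj
    rw [e.symm_apply_apply] at this
    have := congrArg Subtype.val this
    simpa using this

end FreeGroup

/-- An element that is a power of other elements in the trivial way only. -/
def IsRootFree {G : Type*} [Group G] (r : G) : Prop :=
  ∀ (c : G) (n : ℤ), c ^ n = r → n = 1 ∨ n = -1

theorem IsRootFree.mem_zpowers_of_commute {G : Type u} [Group G] [IsFreeGroup G] {g r : G}
    (hr : IsRootFree r) (h : Commute g r) : g ∈ Subgroup.zpowers r := by
  obtain ⟨c, i, j, rfl, rfl⟩ := FreeGroup.exists_zpow_of_commute h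
  rcases hr c j rfl with rfl | rfl
  · exact ⟨i, by simp⟩
  · exact ⟨-i, by simp⟩

theorem IsRootFree.map {G H : Type*} [Group G] [Group H] {r : G} (hr : IsRootFree r)
    (e : G ≃* H) : IsRootFree (e r) := by
  intro c n h
  refine hr (e.symm c) n ?_
  rw [← map_zpow, h, e.symm_apply_apply]

/-- The squares in the alternating group on four points are the identity and the 3-cycles; this
value of `twist` is not among them. It shows that v is not a square in a free group. -/
theorem exists_forall_sq_ne_twist :
    ∃ p q r : alternatingGroup (Fin 4), ∀ g, g * g ≠ twist p q r :=
  ⟨⟨c[1, 2, 3], Equiv.Perm.mem_alternatingGroup.2 (by decide)⟩,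
    ⟨c[3, 2, 1], Equiv.Perm.mem_alternatingGroup.2 (by decide)⟩,
    ⟨c[0, 1, 2], Equiv.Perm.mem_alternatingGroup.2 (by decide)⟩, by decide +kernel⟩

namespace FreeGroup

variable {α : Type u} {a b y : α}

theorem isRootFree_of (a : α) : IsRootFree (of a) := by
  classical
  intro c n h
  have h1 := congrArg (fun g => (lift fun _ : α => Multiplicative.ofAdd (1 : ℤ)) g) h
  have h2 : n * Multiplicative.toAdd ((lift fun _ : α => Multiplicative.ofAdd (1 : ℤ)) c) = 1 := by
    have := congrArg Multiplicative.toAdd h1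
    simpa using this
  exact Int.isUnit_iff.1 (IsUnit.of_mul_eq_one _ h2)

/-- The exponent sum of a in v is 2, so v = c ^ n forces n ∣ 2. An even n would make v a square,
which a quotient onto permutations excludes. -/
theorem isRootFree_twist (hya : y ≠ a) (hyb : y ≠ b) (hab : a ≠ b) :
    IsRootFree (twist (of a) (of b) (of y)) := by
  classical
  intro c n h
  let f : FreeGroup α →* Multiplicative ℤ :=
    lift fun z => if z = a then Multiplicative.ofAdd 1 else 1
  have h2 : n * Multiplicative.toAdd (f c) = 2 := by
    have := congrArg (fun g => Multiplicative.toAdd (f g)) h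
    simpa [f, twist, hya, hab.symm] using this
  obtain ⟨p₁, p₂, p₃, hp⟩ := exists_forall_sq_ne_twist
  let q : FreeGroup α →* alternatingGroup (Fin 4) := lift fun z =>
    if z = a then p₁ else if z = b then p₂ else if z = y then p₃ else 1
  have hq : ∀ g : alternatingGroup (Fin 4), g * g ≠ q (twist (of a) (of b) (of y)) := by
    have e : q (twist (of a) (of b) (of y)) = twist p₁ p₂ p₃ := by
      simp [q, map_twist, hya, hyb, hab.symm]
    rwa [e]
  have hodd : ¬ Even n := by
    rintro ⟨k, rfl⟩
    apply hq (q (c ^ k))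
    rw [← _root_.map_mul, ← zpow_add, h]
  have hdvd : n ∣ 2 := ⟨_, h2.symm⟩
  have h3 : n.natAbs ∣ 2 := by exact_mod_cast Int.natAbs_dvd_natAbs.2 hdvd
  rcases (Nat.dvd_prime Nat.prime_two).1 h3 with h4 | h4
  · omega
  · exact absurd (by rw [Int.even_iff]; omega) hodd

/-- Roots are unique in a free group: if a ^ i = (b a b⁻¹) ^ i with i ≠ 0, then a and b commute. -/
theorem zpow_eq_one_of_commute_of {i : ℤ} (hab : a ≠ b) (h : Commute (of a ^ i) (of b)) :
    i = 0 := by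
  by_contra hi
  have h1 : (of b * of a * (of b)⁻¹) ^ i = of a ^ i := by
    rw [conj_zpow, ← h.eq]; group
  have h2 := zpow_left_injective hi h1
  exact hab (eq_of_commute_of (mul_inv_eq_iff_eq_mul.1 h2)).symm

/-- In the subgroup generated by `a` and `b` no `twist` is conjugate to the generic one. -/
theorem not_isConj_twist_of_mem_closure (hya : y ≠ a) (hyb : y ≠ b) (hab : a ≠ b)
    {w : FreeGroup α} (hw : w ∈ Subgroup.closure (of '' {a, b})) :
    ¬ IsConj (twist (of a) (of b) w) (twist (of a) (of b) (of y)) := by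
  classical
  intro h
  -- Each `q g` sends a to a transposition, b to 1 and y to g, so the image of w does not depend on
  -- g. But the image of v(y) is 1 for g = 1 and is not 1 for g a 3-cycle.
  let q (g : Equiv.Perm (Fin 3)) : FreeGroup α →* Equiv.Perm (Fin 3) := lift fun z =>
    if z = a then c[1, 2] else if z = y then g else 1
  have hqw : ∀ g, q g w = q 1 w := by
    intro g
    clear h
    induction hw using Subgroup.closure_induction with
    | mem x hx =>
      obtain ⟨z, rfl | rfl, rfl⟩ := hx
      · simp [q]
      · simp [q, hyb.symm]
    | one => simp
    | mul x y _ _ hx hy => rw [_root_.map_mul, _root_.map_mul, hx, hy]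
    | inv x _ hx => rw [_root_.map_inv, _root_.map_inv, hx]
  have hq : ∀ g, IsConj (twist c[1, 2] 1 (q 1 w)) (twist c[1, 2] 1 g) := by
    intro g
    have := (q g).map_isConj h
    rw [map_twist, map_twist, hqw] at this
    simpa [q, hya, hab.symm, hyb.symm] using this
  have h1 := (hq 1).symm.trans (hq c[0, 1, 2])
  have h2 : twist (c[1, 2] : Equiv.Perm (Fin 3)) 1 1 = 1 := by decide
  rw [h2, isConj_one_right] at h1
  revert h1
  decide

end FreeGroup

/-! ### The key equation: v(w) conjugate to v(y). -/

namespace FreeGroup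

variable {α : Type u} {a b y : α}

/-- Both g and k commute with a, so they are powers of a; the exponents cancel in k b g = b, and
then g commutes with b. -/
theorem eq_one_of_conj_eq (hab : a ≠ b) {g k : FreeGroup α} (h₁ : g⁻¹ * of a * g = of a)
    (h₂ : k * of b * g = of b) (h₃ : k * of a * k⁻¹ = of a) : g = 1 ∧ k = 1 := by
  classical
  have c₁ : Commute g (of a) := by
    have : of a * g = g * of a := by
      conv_rhs => rw [← h₁]
      group
    exact this.symm
  have c₃ : Commute k (of a) := mul_inv_eq_iff_eq_mul.1 h₃
  obtain ⟨i, rfl⟩ := (isRootFree_of a).mem_zpowers_of_commute c₁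
  obtain ⟨j, rfl⟩ := (isRootFree_of a).mem_zpowers_of_commute c₃
  simp only at h₂
  have hij : j + i = 0 := by
    have := congrArg (fun g => Multiplicative.toAdd
      ((lift fun z : α => if z = a then Multiplicative.ofAdd (1 : ℤ) else 1) g)) h₂
    simpa [hab.symm] using this
  obtain rfl : j = -i := by omega
  have hi : i = 0 := by
    refine zpow_eq_one_of_commute_of hab ?_
    rw [zpow_neg, mul_assoc, inv_mul_eq_iff_eq_mul] at h₂
    exact h₂.symm
  simp [hi]

/-- If `a w b w a w⁻¹ b w⁻¹` and `a y b y a y⁻¹ b y⁻¹` are conjugate in the free group on a set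
with different elements `a`, `b`, `y`, then `w` is `y` or `y⁻¹`. -/
theorem eq_or_eq_inv_of_isConj_twist (hya : y ≠ a) (hyb : y ≠ b) (hab : a ≠ b) {w : FreeGroup α}
    (h : IsConj (twist (of a) (of b) w) (twist (of a) (of b) (of y))) :
    w = of y ∨ w = (of y)⁻¹ := by
  classical
  obtain ⟨P, X, Q, hw, hP, hQ, hX, hX'⟩ :=
    exists_eq_append_append (fun s => s = a ∨ s = b) w.toWord
  have hw' : w = mk P * mk X * mk Q := by rw [mul_mk, mul_mk, ← hw, mk_toWord]
  have hP' : mk P ∈ Subgroup.closure (of '' {a, b}) := mk_mem_closure hP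
  have hQ' : mk Q ∈ Subgroup.closure (of '' {a, b}) := mk_mem_closure hQ
  have ha' : of a ∈ Subgroup.closure (of '' {a, b}) := Subgroup.subset_closure ⟨a, by simp⟩
  have hb' : of b ∈ Subgroup.closure (of '' {a, b}) := Subgroup.subset_closure ⟨b, by simp⟩
  by_cases hX0 : X = []
  · refine absurd h (not_isConj_twist_of_mem_closure hya hyb hab ?_)
    rw [hw', hX0, ← one_eq_mk, mul_one]
    exact mul_mem hP' hQ'
  have hXr : IsReduced X := isReduced_toWord.infix ⟨P, Q, hw.symm⟩
  have hXc : IsCore (fun s => s = a ∨ s = b) X := ⟨hXr, hX0, hX, hX'⟩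
  set g := mk P
  set x := mk X with hx
  set k := mk Q
  have hxi : mk (invRev X) = x⁻¹ := inv_mk.symm
  have toW : ∀ c : FreeGroup α, c ∈ Subgroup.closure (of '' {a, b}) →
      ∀ s ∈ c.toWord, s.1 = a ∨ s.1 = b := fun c hc => forall_mem_toWord_of_mem_closure hc
  -- With w = g x k, conjugating v(w) by g⁻¹ gives c₁ x c₂ x c₃ x⁻¹ c₄ x⁻¹, where c₁ = g⁻¹ a g, c₂ =
  -- k b g, c₃ = k a k⁻¹, c₄ = g⁻¹ b k⁻¹ lie in ⟨a, b⟩. The syllables c₁ and c₃ are never trivial.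
  have hc₁ := toW (g⁻¹ * of a * g) (mul_mem (mul_mem (inv_mem hP') ha') hP')
  have hc₂ := toW (k * of b * g) (mul_mem (mul_mem hQ' hb') hP')
  have hc₃ := toW (k * of a * k⁻¹) (mul_mem (mul_mem hQ' ha') (inv_mem hQ'))
  have hc₄ := toW (g⁻¹ * of b * k⁻¹) (mul_mem (mul_mem (inv_mem hP') hb') (inv_mem hQ'))
  have conj_ne : ∀ c d e : FreeGroup α, c * d * e = 1 → e = c⁻¹ → d = 1 := by
    rintro c d _ h rfl
    simpa using mul_inv_eq_one.1 h
  have n₁ : (g⁻¹ * of a * g).toWord ≠ [] := fun h0 =>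
    of_ne_one a (conj_ne _ _ _ (toWord_eq_nil_iff.1 h0) (inv_inv g).symm)
  have n₃ : (k * of a * k⁻¹).toWord ≠ [] := fun h0 =>
    of_ne_one a (conj_ne _ _ _ (toWord_eq_nil_iff.1 h0) rfl)
  have hV := isCyclicallyReduced_twistWord hya hyb
  rw [← mk_twistWord] at h
  have blk : ∀ c : FreeGroup α, c.toWord ≠ [] → (∀ s ∈ c.toWord, s.1 = a ∨ s.1 = b) →
      ∀ Y, IsCore (fun s => s = a ∨ s = b) Y →
      IsBlock (fun s => s = a ∨ s = b) (c.toWord ++ Y) :=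
    fun c h₁ h₂ Y hY => hY.isBlock isReduced_toWord h₁ h₂
  obtain ⟨S, hS, hSm, hSl⟩ := hXc.exists_sq
  -- If c₂ = 1 the two factors x merge. Then c₄ ≠ 1, since otherwise b² = 1.
  by_cases n₂ : k * of b * g = 1
  · have n₄ : (g⁻¹ * of b * k⁻¹).toWord ≠ [] := by
      rw [Ne, toWord_eq_nil_iff]
      intro h4
      have hk : k = (of b * g)⁻¹ := eq_inv_of_mul_eq_one_left (by rw [← mul_assoc, n₂])
      rw [hk, inv_inv] at h4
      have h5 : g⁻¹ * (of b * of b) * g = 1 := by rw [← h4]; group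
      have h6 := conj_ne _ _ _ h5 (inv_inv g).symm
      rw [← sq, _root_.pow_eq_one_iff_left two_ne_zero] at h6
      exact of_ne_one b h6
    exfalso
    refine not_blocks_isRotated hya hyb n₁ n₃ n₄ hS hXc.invRev (X₃ := invRev X) rfl
      (by simpa using hSl) (IsCyclicallyReduced.isRotated_of_isConj
        (((blk _ n₁ hc₁ _ hS).append (blk _ n₃ hc₃ _ hXc.invRev)).append
          (blk _ n₄ hc₄ _ hXc.invRev)).isCyclicallyReduced hV
        (IsConj.trans (isConj_iff.2 ⟨g, ?_⟩) h))
    simp only [← mul_mk, mk_toWord, hSm, hxi, ← hx]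
    have hk : k = g⁻¹ * (of b)⁻¹ := by
      rw [eq_inv_of_mul_eq_one_left (by rw [← mul_assoc, n₂] : k * (of b * g) = 1), mul_inv_rev]
    rw [hw', twist, hk]
    group
  -- If c₄ = 1 the two factors x⁻¹ merge; the cyclic word is read from c₃ onwards.
  by_cases n₄ : g⁻¹ * of b * k⁻¹ = 1
  · exfalso
    rw [← toWord_eq_nil_iff] at n₂
    refine not_blocks_isRotated hya hyb n₃ n₁ n₂ hS.invRev hXc (X₃ := X) rfl
      (by simpa using hSl) (IsCyclicallyReduced.isRotated_of_isConj
        (((blk _ n₃ hc₃ _ hS.invRev).append (blk _ n₁ hc₁ _ hXc)).append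
          (blk _ n₂ hc₂ _ hXc)).isCyclicallyReduced hV
        (IsConj.trans (isConj_iff.2 ⟨of a * g * x * (k * of b * g) * x, ?_⟩) h))
    simp only [← mul_mk, mk_toWord, ← inv_mk, hSm, ← hx]
    have hk : k = g⁻¹ * of b := (mul_inv_eq_one.1 n₄).symm
    rw [hw', twist, hk]
    group
  rw [← toWord_eq_nil_iff] at n₂ n₄
  have hrot := IsCyclicallyReduced.isRotated_of_isConj
    ((((blk _ n₁ hc₁ _ hXc).append (blk _ n₂ hc₂ _ hXc)).append
      (blk _ n₃ hc₃ _ hXc.invRev)).append (blk _ n₄ hc₄ _ hXc.invRev)).isCyclicallyReduced hV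
    (IsConj.trans (isConj_iff.2 ⟨g, by
      simp only [← mul_mk, mk_toWord, hxi, ← hx]
      rw [hw', twist]
      group⟩) h)
  obtain ⟨e₁, e₂, e₃, e₅⟩ := eq_of_blocks_isRotated hya hyb hab n₁ n₂ n₃ n₄ hX0 hc₁ hrot
  rw [← toWord_of, toWord_inj] at e₁ e₂ e₃
  obtain ⟨hg, hk⟩ := eq_one_of_conj_eq hab e₁ e₂ e₃
  rw [hw', hg, hk, one_mul, mul_one]
  rcases e₅ with e | e
  · left; rw [hx, e]; rfl
  · right; rw [hx, e]; simp [of, invRev]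

end FreeGroup

/-! ### Homomorphisms out of the HNN-extension, and freeness of F. -/

section CyclicHNN

variable {G : Type w} [Group G]

theorem cyclicEquiv_zpow (x y : G) (h : orderOf x = orderOf y) (n : ℤ) :
    cyclicEquiv x y h ⟨x ^ n, n, rfl⟩ = ⟨y ^ n, n, rfl⟩ := by
  have h1 : (⟨x ^ n, n, rfl⟩ : Subgroup.zpowers x) = ⟨x, Subgroup.mem_zpowers x⟩ ^ n := rfl
  rw [h1, map_zpow, cyclicEquiv_apply]
  rfl

/-- The universal property of `⟨G, t | u ^ t = v⟩`. -/
noncomputable def CyclicHNN.lift {K : Type*} [Group K] {u v : G} {h : orderOf u = orderOf v}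
    (f : G →* K) (s : K) (hs : s⁻¹ * f u * s = f v) : CyclicHNN u v h →* K :=
  HNNExtension.lift f s (by
    rintro ⟨_, n, rfl⟩
    have h1 := cyclicEquiv_zpow v u h.symm n
    simp only [map_zpow] at h1 ⊢
    rw [h1]
    simp only [map_zpow]
    have h2 : (s⁻¹ * f u * s) ^ n = s⁻¹ * f u ^ n * s := by
      simpa using (conj_zpow (i := n) (a := s⁻¹) (b := f u))
    rw [← hs, h2]
    group)

variable {K : Type*} [Group K] {u v : G} {h : orderOf u = orderOf v}

@[simp]
theorem CyclicHNN.lift_of (f : G →* K) (s : K) (hs : s⁻¹ * f u * s = f v) (g : G) :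
    CyclicHNN.lift (h := h) f s hs (HNNExtension.of g) = f g :=
  HNNExtension.lift_of _ _ _ _

@[simp]
theorem CyclicHNN.lift_t (f : G →* K) (s : K) (hs : s⁻¹ * f u * s = f v) :
    CyclicHNN.lift (h := h) f s hs HNNExtension.t = s :=
  HNNExtension.lift_t _ _ _

end CyclicHNN

namespace Counterexample

variable (A₀ : Type u)

/-- The inclusion of `A` in `F`. -/
noncomputable def ofA : GroupA A₀ →* GroupF A₀ :=
  (HNNExtension.of : GroupH A₀ →* GroupF A₀).comp Monoid.Coprod.inl

/-- The stable letter of `F`. -/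
noncomputable def t : GroupF A₀ := HNNExtension.t

theorem ofA_mem_subA (x : GroupA A₀) : ofA A₀ x ∈ subA A₀ := ⟨x, rfl⟩

variable {A₀}

/-- The element `v = a y b y a y⁻¹ b y⁻¹` with `y` replaced by `w`. -/
noncomputable def twistF (w : GroupF A₀) : GroupF A₀ :=
  twist (ofA A₀ (.of .a)) (ofA A₀ (.of .b)) w

theorem twistF_y : twistF (y A₀) = HNNExtension.of (elV A₀) := by
  exact (map_twist (HNNExtension.of : GroupH A₀ →* GroupF A₀) (elA A₀) (elB A₀) (elY A₀)).symm

theorem t_rel : (t A₀)⁻¹ * ofA A₀ (.of .u) * t A₀ = twistF (y A₀) := by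
  rw [twistF_y]
  exact CyclicHNN.rel (elU A₀) (elV A₀) (orderOf_elU_eq_elV A₀)

theorem ofA_u : ofA A₀ (.of .u) = t A₀ * twistF (y A₀) * (t A₀)⁻¹ := by
  rw [← t_rel]; group

theorem closure_subA_y : Subgroup.closure ((subA A₀ : Set (GroupF A₀)) ∪ {y A₀}) = subH A₀ := by
  have hA : (subA A₀ : Set (GroupF A₀)) =
      (HNNExtension.of : GroupH A₀ →* GroupF A₀) '' (Set.range Monoid.Coprod.inl) := by
    ext x; simp [subA]
  apply le_antisymm
  · rw [Subgroup.closure_le]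
    rintro _ (⟨x, rfl⟩ | rfl)
    exacts [⟨_, rfl⟩, ⟨_, rfl⟩]
  · rintro _ ⟨x, rfl⟩
    induction x using Monoid.Coprod.induction_on with
    | inl m => exact Subgroup.subset_closure (Or.inl ⟨m, rfl⟩)
    | inr n =>
      induction n using FreeGroup.induction_on with
      | C1 => simp
      | of x => exact Subgroup.subset_closure (Or.inr rfl)
      | inv_of x hx => rw [map_inv, map_inv]; exact inv_mem hx
      | mul x y hx hy => rw [map_mul, map_mul]; exact mul_mem hx hy
    | mul x y hx hy => rw [map_mul]; exact mul_mem hx hy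

variable {G : Type*} [Group G]

/-- Homomorphisms on `F` are given by a homomorphism on `A` and the images of `y` and `t`. -/
noncomputable def lift (f : GroupA A₀ →* G) (w s : G)
    (h : s⁻¹ * f (.of .u) * s = twist (f (.of .a)) (f (.of .b)) w) : GroupF A₀ →* G :=
  CyclicHNN.lift (Monoid.Coprod.lift f (FreeGroup.lift fun _ => w)) s (by
    simpa [elU, elV, elA, elB, elY, twist] using h)

section

variable (f : GroupA A₀ →* G) (w s : G)
    (h : s⁻¹ * f (.of .u) * s = twist (f (.of .a)) (f (.of .b)) w)

@[simp]
theorem lift_ofA (x : GroupA A₀) : lift f w s h (ofA A₀ x) = f x := by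
  simp [lift, ofA]

@[simp]
theorem lift_y : lift f w s h (y A₀) = w := by
  simp [lift, y, elY]

@[simp]
theorem lift_t : lift f w s h (t A₀) = s := by
  simp [lift, t]

end

theorem hom_ext_H {f g : GroupF A₀ →* G} (hA : ∀ x, f (ofA A₀ x) = g (ofA A₀ x))
    (hy : f (y A₀) = g (y A₀)) {x : GroupF A₀} (hx : x ∈ subH A₀) : f x = g x := by
  rw [← closure_subA_y] at hx
  refine MonoidHom.eqOn_closure ?_ hx
  rintro _ (⟨x, rfl⟩ | rfl)
  exacts [hA x, hy]

theorem hom_ext {f g : GroupF A₀ →* G} (hA : ∀ x, f (ofA A₀ x) = g (ofA A₀ x))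
    (hy : f (y A₀) = g (y A₀)) (ht : f (t A₀) = g (t A₀)) : f = g := by
  apply HNNExtension.hom_ext
  · refine MonoidHom.ext fun x => ?_
    exact hom_ext_H hA hy ⟨x, rfl⟩
  · exact ht

variable (A₀)

/-- `F` is free on `A₀`, `a`, `b`, `y`, `t`; the letter `some Gen.u` stands for `t` and the letter
`none` for `y`. -/
noncomputable def toFree : GroupF A₀ →* FreeGroup (Option (Gen A₀)) :=
  lift (FreeGroup.lift fun g => match g with
      | .u => FreeGroup.of (some .u) *
          twist (.of (some .a)) (.of (some .b)) (.of none) * (FreeGroup.of (some .u))⁻¹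
      | g => .of (some g))
    (.of none) (.of (some .u)) (by simp [mul_assoc])

/-- The inverse of `toFree`. -/
noncomputable def ofFree : FreeGroup (Option (Gen A₀)) →* GroupF A₀ :=
  FreeGroup.lift fun g => match g with
    | none => y A₀
    | some .u => t A₀
    | some g => ofA A₀ (.of g)

/-- `F` is isomorphic to a free group. -/
noncomputable def equivFree : GroupF A₀ ≃* FreeGroup (Option (Gen A₀)) :=
  MonoidHom.toMulEquiv (toFree A₀) (ofFree A₀)
    (by
      apply hom_ext
      · intro x
        suffices h : ((ofFree A₀).comp (toFree A₀)).comp (ofA A₀) =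
            (MonoidHom.id _).comp (ofA A₀) from DFunLike.congr_fun h x
        ext g
        cases g <;> simp [ofFree, toFree, map_twist]
        rw [ofA_u, twistF]
      · simp [ofFree, toFree]
      · simp [ofFree, toFree])
    (by
      ext g
      rcases g with _ | g
      · simp [ofFree, toFree]
      · cases g <;> simp [ofFree, toFree])

@[simp]
theorem equivFree_a : equivFree A₀ (ofA A₀ (.of .a)) = .of (some .a) := by
  simp [equivFree, toFree]

@[simp]
theorem equivFree_b : equivFree A₀ (ofA A₀ (.of .b)) = .of (some .b) := by
  simp [equivFree, toFree]

@[simp]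
theorem equivFree_y : equivFree A₀ (y A₀) = .of none := by
  simp [equivFree, toFree]

/-- The letters of `A₀` and four further letters. -/
def genEquiv : Option (Gen A₀) ≃ A₀ ⊕ Fin 4 where
  toFun g := match g with
    | none => .inr 0
    | some .a => .inr 1
    | some .b => .inr 2
    | some .u => .inr 3
    | some (.base x) => .inl x
  invFun g := match g with
    | .inr 0 => none
    | .inr 1 => some .a
    | .inr 2 => some .b
    | .inr 3 => some .u
    | .inl x => some (.base x)
  left_inv g := by rcases g with _ | g <;> [rfl; cases g <;> rfl]
  right_inv g := by rcases g with x | g <;> [rfl; fin_cases g <;> rfl]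

theorem nonempty_freeGroupBasis [Finite A₀] :
    Nonempty (FreeGroupBasis (Fin (Nat.card A₀ + 4)) (GroupF A₀)) := by
  have e : Option (Gen A₀) ≃ Fin (Nat.card A₀ + 4) := (genEquiv A₀).trans
    ((Equiv.sumCongr (Finite.equivFin A₀) (Equiv.refl _)).trans finSumFinEquiv)
  exact ⟨(FreeGroupBasis.ofRepr (equivFree A₀)).reindex e⟩

instance : IsFreeGroup (GroupF A₀) := .ofMulEquiv (equivFree A₀).symm

instance : IsMulTorsionFree (GroupF A₀) :=
  Function.Injective.isMulTorsionFree (equivFree A₀).toMonoidHom (equivFree A₀).injective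

variable {A₀}

theorem eq_or_eq_inv_of_isConj {w : GroupF A₀} (h : IsConj (twistF w) (twistF (y A₀))) :
    w = y A₀ ∨ w = (y A₀)⁻¹ := by
  have h1 := (equivFree A₀).toMonoidHom.map_isConj h
  simp only [twistF, map_twist, MulEquiv.toMonoidHom_eq_coe, MonoidHom.coe_coe, equivFree_a,
    equivFree_b, equivFree_y] at h1
  rcases FreeGroup.eq_or_eq_inv_of_isConj_twist (by simp) (by simp) (by simp) h1 with h2 | h2
  · left; apply (equivFree A₀).injective; simpa using h2
  · right; apply (equivFree A₀).injective; simpa using h2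

theorem isRootFree_twistF : IsRootFree (twistF (y A₀)) := by
  have h := (FreeGroup.isRootFree_twist (a := some Gen.a) (b := some Gen.b)
    (y := (none : Option (Gen A₀))) (by simp) (by simp) (by simp)).map (equivFree A₀).symm
  convert h
  apply (equivFree A₀).injective
  have := map_twist (equivFree A₀).toMonoidHom (ofA A₀ (.of .a)) (ofA A₀ (.of .b)) (y A₀)
  simpa [twistF] using this

/-- In F the element u is no longer a basis letter, but it is conjugate to v. Consequently its
centralizer is ⟨u⟩. -/
theorem isRootFree_ofA_u : IsRootFree (ofA A₀ (.of .u)) := by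
  have h := (isRootFree_twistF (A₀ := A₀)).map (MulAut.conj (t A₀))
  rwa [MulAut.conj_apply, ← ofA_u] at h

end Counterexample

/-! ### Tools for fixed points: inverting letters, and conjugates of powers. -/

namespace FreeGroup

variable {α : Type u}

/-- The endomorphism of a free group that inverts the generators satisfying `p`. -/
def invertOn (p : α → Prop) [DecidablePred p] : FreeGroup α →* FreeGroup α :=
  lift fun z => if p z then (of z)⁻¹ else of z

theorem invertOn_mk (p : α → Prop) [DecidablePred p] (L : List (α × Bool)) :
    invertOn p (mk L) = mk (L.map fun s => (s.1, if p s.1 then !s.2 else s.2)) := by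
  induction L with
  | nil => simp [← one_eq_mk]
  | cons s L ih =>
    have e : ∀ (s : α × Bool) L, mk (s :: L) = mk [s] * mk L := fun _ _ => (mul_mk (L₁ := [_])).symm
    rw [List.map_cons, e, e, _root_.map_mul, ih]
    obtain ⟨z, b⟩ := s
    by_cases hz : p z <;> cases b <;> simp [invertOn, hz, of, invRev]

/-- Inverting all occurrences of given letters keeps a word reduced, so a fixed element has a word
that is fixed letter by letter. -/
theorem not_of_mem_toWord_of_invertOn_eq [DecidableEq α] (p : α → Prop) [DecidablePred p]
    {w : FreeGroup α} (h : invertOn p w = w) : ∀ s ∈ w.toWord, ¬ p s.1 := by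
  have hr : IsReduced w.toWord := isReduced_toWord
  rw [← mk_toWord (x := w), invertOn_mk] at h
  have hr' : IsReduced (w.toWord.map fun s => (s.1, if p s.1 then !s.2 else s.2)) := by
    unfold IsReduced
    rw [List.isChain_map]
    refine List.IsChain.imp (fun s r h1 h2 => ?_) hr
    simp only at h2 ⊢
    rw [h2, h1 h2]
  have h2 := mk_injOn_isReduced hr' hr h
  intro s hs hp
  have h3 := List.map_inj_left.1 (h2.trans (List.map_id _).symm) s hs
  have h4 := congrArg Prod.snd h3
  simp [hp] at h4

end FreeGroup

/-- The homomorphism `f` forces g⁻¹ r^k g = r^k; by uniqueness of roots g commutes with r. -/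
theorem mem_zpowers_of_conj_zpow_mem {G : Type u} [Group G] [IsFreeGroup G] [IsMulTorsionFree G]
    {r g : G} (hr : IsRootFree r) (f : G →* Multiplicative ℤ) (hf : f r ≠ 1) {k : ℤ} (hk : k ≠ 0)
    (h : g⁻¹ * r ^ k * g ∈ Subgroup.zpowers r) : g ∈ Subgroup.zpowers r := by
  obtain ⟨j, hj⟩ := h
  simp only at hj
  have hjk : j = k := by
    have h1 := congrArg (fun g => Multiplicative.toAdd (f g)) hj
    have h2 : Multiplicative.toAdd (f r) ≠ 0 := hf
    simpa [h2] using h1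
  subst hjk
  have h1 : (g⁻¹ * r * g) ^ j = r ^ j := by
    rw [hj]
    simpa using (conj_zpow (i := j) (a := g⁻¹) (b := r))
  have h2 := zpow_left_injective hk h1
  refine hr.mem_zpowers_of_commute ?_
  have h3 : r * g = g * r := by
    conv_rhs => rw [← h2]
    group
  exact h3.symm

theorem conj_zpow_notMem_zpowers {G : Type u} [Group G] {r q g : G} (f : G →* Multiplicative ℤ)
    (hr : f r ≠ 1) (hq : f q = 1) {k : ℤ} (hk : k ≠ 0) :
    g⁻¹ * r ^ k * g ∉ Subgroup.zpowers q := by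
  rintro ⟨j, hj⟩
  have h1 := congrArg (fun g => Multiplicative.toAdd (f g)) hj
  have h2 : Multiplicative.toAdd (f r) ≠ 0 := hr
  simp [hq] at h1
  tauto

/-! ### The endomorphisms of F over A. -/

namespace Counterexample

variable (A₀ : Type u)

/-- `H` is free on `A₀`, `a`, `b`, `u`, `y`; the letter `none` stands for `y`. -/
def equivFreeH : GroupH A₀ ≃* FreeGroup (Option (Gen A₀)) :=
  MonoidHom.toMulEquiv
    (Monoid.Coprod.lift (FreeGroup.lift fun g => .of (some g)) (FreeGroup.lift fun _ => .of none))
    (FreeGroup.lift fun g => match g with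
      | none => elY A₀
      | some g => Monoid.Coprod.inl (.of g))
    (by
      apply Monoid.Coprod.hom_ext
      · ext g; simp
      · ext g; simp [elY])
    (by
      ext g
      rcases g with _ | g <;> simp [elY])

@[simp]
theorem equivFreeH_inl (g : Gen A₀) :
    equivFreeH A₀ (Monoid.Coprod.inl (.of g)) = .of (some g) := by
  simp [equivFreeH]

@[simp]
theorem equivFreeH_elY : equivFreeH A₀ (elY A₀) = .of none := by
  simp [equivFreeH, elY]

@[simp]
theorem equivFreeH_symm_some (g : Gen A₀) :
    (equivFreeH A₀).symm (.of (some g)) = Monoid.Coprod.inl (.of g) := by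
  rw [MulEquiv.symm_apply_eq, equivFreeH_inl]

@[simp]
theorem equivFreeH_symm_none : (equivFreeH A₀).symm (.of none) = elY A₀ := by
  rw [MulEquiv.symm_apply_eq, equivFreeH_elY]

instance : IsFreeGroup (GroupH A₀) := .ofMulEquiv (equivFreeH A₀).symm

instance : IsMulTorsionFree (GroupH A₀) :=
  Function.Injective.isMulTorsionFree (equivFreeH A₀).toMonoidHom (equivFreeH A₀).injective

theorem isRootFree_elU : IsRootFree (elU A₀) := by
  have h := (FreeGroup.isRootFree_of (some (Gen.u : Gen A₀))).map (equivFreeH A₀).symm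
  rwa [equivFreeH_symm_some] at h

theorem isRootFree_elV : IsRootFree (elV A₀) := by
  have h := (FreeGroup.isRootFree_twist (a := some Gen.a) (b := some Gen.b)
    (y := (none : Option (Gen A₀))) (by simp) (by simp) (by simp)).map (equivFreeH A₀).symm
  simpa [twist, elV, elA, elB] using h

/-- A homomorphism on `H` that separates `u` from `v`. -/
theorem exists_hom_elU : ∃ f : GroupH A₀ →* Multiplicative ℤ, f (elU A₀) ≠ 1 ∧ f (elV A₀) = 1 :=
  ⟨Monoid.Coprod.lift
    (FreeGroup.lift fun g => match g with
      | Gen.u => Multiplicative.ofAdd (1 : ℤ)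
      | _ => 1) 1, by simp [elU], by simp [elV, elA, elB, elY]⟩

theorem exists_hom_elV : ∃ f : GroupH A₀ →* Multiplicative ℤ, f (elV A₀) ≠ 1 ∧ f (elU A₀) = 1 :=
  ⟨Monoid.Coprod.lift
    (FreeGroup.lift fun g => match g with
      | Gen.a => Multiplicative.ofAdd (1 : ℤ)
      | _ => 1) 1, by simp [elV, elA, elB, elY]; decide, by simp [elU]⟩

variable {A₀}

/-- The endomorphism of `F` that fixes `H` and sends `t` to `u ^ k * t`. -/
noncomputable def shift (k : ℤ) : GroupF A₀ →* GroupF A₀ :=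
  lift (ofA A₀) (y A₀) (ofA A₀ (.of .u) ^ k * t A₀) (by
    have h : (ofA A₀ (.of .u) ^ k * t A₀)⁻¹ * ofA A₀ (.of .u) * (ofA A₀ (.of .u) ^ k * t A₀) =
      (t A₀)⁻¹ * ofA A₀ (.of .u) * t A₀ := by group
    rw [h, t_rel, twistF])

@[simp] theorem shift_ofA (k : ℤ) (x : GroupA A₀) : shift k (ofA A₀ x) = ofA A₀ x := lift_ofA ..

@[simp] theorem shift_y (k : ℤ) : shift k (y A₀) = y A₀ := lift_y ..

@[simp] theorem shift_t (k : ℤ) : shift k (t A₀) = ofA A₀ (.of .u) ^ k * t A₀ := lift_t ..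

theorem shift_shift (j k : ℤ) (x : GroupF A₀) : shift j (shift k x) = shift (j + k) x := by
  suffices h : (shift j).comp (shift k) = shift (A₀ := A₀) (j + k) from DFunLike.congr_fun h x
  apply hom_ext
  · simp
  · simp
  · simp only [MonoidHom.comp_apply, shift_t, map_mul, map_zpow, shift_ofA]
    group

theorem shift_zero (x : GroupF A₀) : shift 0 x = x := by
  suffices h : shift 0 = MonoidHom.id (GroupF A₀) from DFunLike.congr_fun h x
  apply hom_ext <;> simp

/-- `shift` as an automorphism. -/
noncomputable def shiftEquiv (k : ℤ) : GroupF A₀ ≃* GroupF A₀ where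
  __ := shift k
  invFun := shift (-k)
  left_inv x := by simp [shift_shift, shift_zero]
  right_inv x := by simp [shift_shift, shift_zero]

/-- The endomorphism of `F` that fixes `A` and inverts `y`. -/
noncomputable def flip : GroupF A₀ →* GroupF A₀ :=
  lift (ofA A₀) (y A₀)⁻¹
    -- Since v = (a y b y)(a y⁻¹ b y⁻¹), conjugating v by a y b y swaps the two halves and yields
    -- v(y⁻¹).
    (t A₀ * (ofA A₀ (.of .a) * y A₀ * ofA A₀ (.of .b) * y A₀)) (by
      rw [ofA_u, twistF, twist, twist]
      group)

@[simp] theorem flip_ofA (x : GroupA A₀) : flip (ofA A₀ x) = ofA A₀ x := lift_ofA ..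

@[simp] theorem flip_y : flip (y A₀) = (y A₀)⁻¹ := lift_y ..

@[simp] theorem flip_t : flip (t A₀) =
    t A₀ * (ofA A₀ (.of .a) * y A₀ * ofA A₀ (.of .b) * y A₀) := lift_t ..

/-- The square sends t to t (a y b y)(a y⁻¹ b y⁻¹) = t v = u t. So `flip` is not an involution, but
it is bijective because its square is. -/
theorem flip_flip (x : GroupF A₀) : flip (flip x) = shift 1 x := by
  suffices h : flip.comp flip = shift (A₀ := A₀) 1 from DFunLike.congr_fun h x
  apply hom_ext
  · simp
  · simp
  · simp only [MonoidHom.comp_apply, shift_t, map_mul, flip_ofA, flip_y, flip_t]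
    rw [ofA_u, twistF, twist]
    group

theorem flip_bijective : Function.Bijective (flip (A₀ := A₀)) := by
  have h : Function.Bijective (flip (A₀ := A₀) ∘ flip) := by
    have : (flip (A₀ := A₀) ∘ flip) = shiftEquiv 1 := funext flip_flip
    rw [this]
    exact (shiftEquiv 1).bijective
  exact ⟨h.1.of_comp, h.2.of_comp⟩

/-- `flip` as an automorphism. -/
noncomputable def flipEquiv : GroupF A₀ ≃* GroupF A₀ := MulEquiv.ofBijective flip flip_bijective

/-- An element that conjugates `u` to a conjugate of `v`. -/
theorem exists_eq_zpow_mul {s r : GroupF A₀}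
    (h : s⁻¹ * ofA A₀ (.of .u) * s = r⁻¹ * ofA A₀ (.of .u) * r) :
    ∃ k : ℤ, s = ofA A₀ (.of .u) ^ k * r := by
  have hc : Commute (s * r⁻¹) (ofA A₀ (.of .u)) := by
    have : ofA A₀ (.of .u) = s * (r⁻¹ * ofA A₀ (.of .u) * r) * s⁻¹ := by rw [← h]; group
    change _ = _
    conv_rhs => rw [this]
    group
  obtain ⟨k, hk⟩ := isRootFree_ofA_u.mem_zpowers_of_commute hc
  exact ⟨k, by simp only at hk; rw [hk]; group⟩

/-- The elements `w`, `s` of `F` with `s⁻¹ u s = v(w)`. -/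
theorem eq_or_eq_inv_of_rel {w s : GroupF A₀} (h : s⁻¹ * ofA A₀ (.of .u) * s = twistF w) :
    w = y A₀ ∨ w = (y A₀)⁻¹ := by
  apply eq_or_eq_inv_of_isConj
  rw [← h, ← t_rel]
  exact isConj_iff.2 ⟨(t A₀)⁻¹ * s, by group⟩

/-- The endomorphisms of `F` over `A`. -/
theorem eq_shift_or_eq_shift_comp_flip {f : GroupF A₀ →* GroupF A₀}
    (hf : ∀ x ∈ subA A₀, f x = x) :
    (∃ k, f = shift k) ∨ ∃ k, f = (shift k).comp flip := by
  have hA : ∀ x, f (ofA A₀ x) = ofA A₀ x := fun x => hf _ (ofA_mem_subA A₀ x)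
  -- The images of y and t solve the defining equation; the key fact gives the first, the
  -- centralizer of u the second.
  have h : (f (t A₀))⁻¹ * ofA A₀ (.of .u) * f (t A₀) = twistF (f (y A₀)) := by
    have := congrArg f (t_rel (A₀ := A₀))
    rwa [twistF, map_twist, map_mul, map_mul, map_inv, hA, hA, hA] at this
  rcases eq_or_eq_inv_of_rel h with hy | hy
  · left
    rw [hy, ← t_rel] at h
    obtain ⟨k, hk⟩ := exists_eq_zpow_mul h
    exact ⟨k, hom_ext (by simp [hA]) (by simp [hy]) (by simp [hk])⟩
  · right
    have h2 := congrArg flip (t_rel (A₀ := A₀))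
    rw [twistF, map_twist, map_mul, map_mul, map_inv, flip_ofA, flip_ofA, flip_ofA, flip_y] at h2
    rw [hy, twistF, ← h2] at h
    obtain ⟨k, hk⟩ := exists_eq_zpow_mul h
    exact ⟨k, hom_ext (by simp [hA]) (by simp [hy]) (by simp [hk, mul_assoc])⟩

theorem bijective_of_fix {f : GroupF A₀ →* GroupF A₀} (hf : ∀ x ∈ subA A₀, f x = x) :
    Function.Bijective f ∧ ((∀ x ∈ subH A₀, f x = x) ∨ f (y A₀) = (y A₀)⁻¹) := by
  rcases eq_shift_or_eq_shift_comp_flip hf with ⟨k, rfl⟩ | ⟨k, rfl⟩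
  · exact ⟨(shiftEquiv k).bijective, Or.inl fun x hx =>
      hom_ext_H (g := MonoidHom.id _) (by simp) (by simp) hx⟩
  · exact ⟨(shiftEquiv k).bijective.comp flip_bijective, Or.inr (by simp)⟩

/-- On the free group H, `flip` inverts the letter y and fixes the others, so a fixed element has no
y in its reduced word. -/
theorem mem_subA_of_flip_eq {x : GroupF A₀} (hx : x ∈ subH A₀) (h : flip x = x) :
    x ∈ subA A₀ := by
  classical
  obtain ⟨g, rfl⟩ := hx
  set e := equivFreeH A₀
  have h1 : ∀ w : FreeGroup (Option (Gen A₀)), flip (HNNExtension.of (e.symm w)) =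
      HNNExtension.of (e.symm (FreeGroup.invertOn (· = none) w)) := by
    intro w
    suffices h : (flip.comp HNNExtension.of).comp e.symm.toMonoidHom =
        ((HNNExtension.of : GroupH A₀ →* GroupF A₀).comp e.symm.toMonoidHom).comp
          (FreeGroup.invertOn (· = none)) from DFunLike.congr_fun h w
    ext z
    rcases z with _ | z
    · simp only [e, FreeGroup.invertOn, MonoidHom.comp_apply, MulEquiv.coe_toMonoidHom,
        FreeGroup.lift_apply_of, if_true, equivFreeH_symm_none, map_inv]
      exact flip_y
    · simp only [e, FreeGroup.invertOn, MonoidHom.comp_apply, MulEquiv.coe_toMonoidHom,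
        FreeGroup.lift_apply_of, reduceCtorEq, if_false, equivFreeH_symm_some]
      exact flip_ofA (.of z)
  have h2 : FreeGroup.invertOn (· = none) (e g) = e g := by
    have := h1 (e g)
    rw [e.symm_apply_apply, h] at this
    have := HNNExtension.of_injective _ this
    rw [← e.apply_symm_apply (FreeGroup.invertOn (· = none) (e g)), ← this]
  have h3 := FreeGroup.mk_mem_closure (S := Set.range some) (L := (e g).toWord) (fun s hs =>
    Option.ne_none_iff_exists.1 (FreeGroup.not_of_mem_toWord_of_invertOn_eq _ h2 s hs))
  rw [FreeGroup.mk_toWord] at h3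
  suffices h4 : Subgroup.closure (FreeGroup.of '' Set.range some) ≤ (subA A₀).comap
      ((HNNExtension.of : GroupH A₀ →* GroupF A₀).comp e.symm.toMonoidHom) by
    simpa using h4 h3
  rw [Subgroup.closure_le]
  rintro _ ⟨_, ⟨z, rfl⟩, rfl⟩
  exact ⟨.of z, by simp [e]⟩

end Counterexample

/-! ### Fixed points of `shift`, by normal forms. -/

namespace Counterexample

variable {A₀ : Type u}

theorem shift_of (k : ℤ) (g : GroupH A₀) :
    shift k (HNNExtension.of g : GroupF A₀) = HNNExtension.of g :=
  hom_ext_H (f := shift k) (g := MonoidHom.id _) (by simp) (by simp) ⟨g, rfl⟩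

variable (A₀) in
/-- The factor by which `shift k` changes the entries of a word in normal form. -/
def shiftFactor (k : ℤ) (ε : ℤˣ) : GroupH A₀ := if ε = 1 then elV A₀ ^ k else elU A₀ ^ (-k)

theorem shiftFactor_mem (k : ℤ) (ε : ℤˣ) : shiftFactor A₀ k ε ∈
    HNNExtension.toSubgroup (Subgroup.zpowers (elV A₀)) (Subgroup.zpowers (elU A₀)) ε := by
  rcases Int.units_eq_one_or ε with rfl | rfl
  · exact ⟨k, by simp [shiftFactor]⟩
  · exact ⟨-k, by simp [shiftFactor]⟩

/-- As u^k t = t v^k, the factor can be moved to the right of the stable letter and absorbed by the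
next entry from H. -/
theorem t_zpow_mul_shiftFactor (k : ℤ) (ε : ℤˣ) :
    shift k (t A₀ ^ (ε : ℤ)) = t A₀ ^ (ε : ℤ) * HNNExtension.of (shiftFactor A₀ k ε) := by
  have hu : (HNNExtension.of (elU A₀) : GroupF A₀) = ofA A₀ (.of .u) := rfl
  rcases Int.units_eq_one_or ε with rfl | rfl
  · simp only [shiftFactor, if_true, map_zpow, ← twistF_y, ← t_rel, Units.val_one, zpow_one,
      shift_t]
    have h2 : ((t A₀)⁻¹ * ofA A₀ (.of .u) * t A₀) ^ k =
        (t A₀)⁻¹ * ofA A₀ (.of .u) ^ k * t A₀ := by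
      simpa using (conj_zpow (i := k) (a := (t A₀)⁻¹) (b := ofA A₀ (.of .u)))
    rw [h2]
    group
  · have h1 : ¬ ((-1 : ℤˣ) = 1) := by decide
    simp only [shiftFactor, h1, if_false, map_zpow, hu, Units.val_neg, Units.val_one, shift_t]
    group

theorem shift_wordProd (k : ℤ) (l : List (ℤˣ × GroupH A₀)) :
    shift k (l.map fun x => t A₀ ^ (x.1 : ℤ) * HNNExtension.of x.2).prod =
      ((l.map fun x => (x.1, shiftFactor A₀ k x.1 * x.2)).map
        fun x => t A₀ ^ (x.1 : ℤ) * HNNExtension.of x.2).prod := by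
  rw [map_list_prod, List.map_map, List.map_map]
  congr 1
  apply List.map_congr_left
  intro x _
  simp only [Function.comp_apply]
  rw [map_mul, t_zpow_mul_shiftFactor, shift_of, mul_assoc, ← map_mul]

theorem isChain_shift (k : ℤ) {l : List (ℤˣ × GroupH A₀)}
    (h : l.IsChain fun a b => a.2 ∈ HNNExtension.toSubgroup (Subgroup.zpowers (elV A₀))
      (Subgroup.zpowers (elU A₀)) a.1 → a.1 = b.1) :
    (l.map fun x => (x.1, shiftFactor A₀ k x.1 * x.2)).IsChain fun a b =>
      a.2 ∈ HNNExtension.toSubgroup (Subgroup.zpowers (elV A₀))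
      (Subgroup.zpowers (elU A₀)) a.1 → a.1 = b.1 := by
  rw [List.isChain_map]
  refine h.imp fun a b hab ha => hab ?_
  exact (Subgroup.mul_mem_cancel_left _ (shiftFactor_mem k a.1)).1 ha

/-- No nontrivial power of u is conjugate in H into ⟨v⟩, nor one of v into ⟨u⟩, as abelian quotients
show; this excludes ε = δ. Otherwise g normalizes a nontrivial power of a root-free element, hence
is a power of it. -/
theorem conj_shiftFactor_mem {k : ℤ} (hk : k ≠ 0) {ε δ : ℤˣ} {g : GroupH A₀}
    (h : g⁻¹ * (shiftFactor A₀ k ε * g) ∈ HNNExtension.toSubgroup (Subgroup.zpowers (elV A₀))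
      (Subgroup.zpowers (elU A₀)) (-δ)) :
    ε ≠ δ ∧ g ∈ HNNExtension.toSubgroup (Subgroup.zpowers (elV A₀))
      (Subgroup.zpowers (elU A₀)) ε := by
  obtain ⟨f, hf, hf'⟩ := exists_hom_elU A₀
  obtain ⟨f₂, hf₂, hf₂'⟩ := exists_hom_elV A₀
  have h1 : ¬ ((-1 : ℤˣ) = 1) := by decide
  rw [← mul_assoc] at h
  rcases Int.units_eq_one_or ε with rfl | rfl <;> rcases Int.units_eq_one_or δ with rfl | rfl
  · exact absurd h (conj_zpow_notMem_zpowers f₂ hf₂ hf₂' hk)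
  · exact ⟨by decide, mem_zpowers_of_conj_zpow_mem (isRootFree_elV A₀) f₂ hf₂ hk h⟩
  · exact ⟨by decide, mem_zpowers_of_conj_zpow_mem (isRootFree_elU A₀) f hf (neg_ne_zero.2 hk) h⟩
  · exact absurd h (conj_zpow_notMem_zpowers f hf hf' (neg_ne_zero.2 hk))

theorem shiftFactor_ne_one {k : ℤ} (hk : k ≠ 0) (ε : ℤˣ) : shiftFactor A₀ k ε ≠ 1 := by
  have key : ∀ {r : GroupH A₀} {k : ℤ}, k ≠ 0 → (∃ f : GroupH A₀ →* Multiplicative ℤ, f r ≠ 1) →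
      r ^ k ≠ 1 := by
    rintro r k hk ⟨f, hf⟩ h
    have h1 := congrArg f h
    rw [map_zpow, map_one, IsMulTorsionFree.zpow_eq_one_iff_left hk] at h1
    exact hf h1
  unfold shiftFactor
  split
  · exact key hk ((exists_hom_elV A₀).imp fun _ h => h.1)
  · exact key (neg_ne_zero.2 hk) ((exists_hom_elU A₀).imp fun _ h => h.1)

theorem mem_subH_of_shift_eq {k : ℤ} (hk : k ≠ 0) {x : GroupF A₀} (h : shift k x = x) :
    x ∈ subH A₀ := by
  obtain ⟨w, rfl⟩ : ∃ w : HNNExtension.NormalWord.ReducedWord (GroupH A₀)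
      (Subgroup.zpowers (elV A₀)) (Subgroup.zpowers (elU A₀)), w.prod _ = x := by
    obtain ⟨d⟩ := HNNExtension.NormalWord.TransversalPair.nonempty (GroupH A₀)
      (Subgroup.zpowers (elV A₀)) (Subgroup.zpowers (elU A₀))
    exact ⟨(x • (HNNExtension.NormalWord.empty : HNNExtension.NormalWord d)).toReducedWord, by
      rw [HNNExtension.NormalWord.prod_smul, HNNExtension.NormalWord.prod_empty, mul_one]⟩
  obtain ⟨g₀, l, hl⟩ := w
  cases l with
  | nil => exact ⟨g₀, by simp [HNNExtension.NormalWord.ReducedWord.prod]⟩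
  | cons a l =>
    exfalso
    obtain ⟨ε, g⟩ := a
    have hl' := (List.isChain_cons.1 hl).2
    -- Cancelling the common prefix g₀ t^ε leaves two reduced words for one element, with initial
    -- entries g and c g, where c is the shift factor.
    let w₁ : HNNExtension.NormalWord.ReducedWord (GroupH A₀)
      (Subgroup.zpowers (elV A₀)) (Subgroup.zpowers (elU A₀)) := ⟨g, l, hl'⟩
    let w₂ : HNNExtension.NormalWord.ReducedWord (GroupH A₀)
      (Subgroup.zpowers (elV A₀)) (Subgroup.zpowers (elU A₀)) :=
      ⟨shiftFactor A₀ k ε * g, _, isChain_shift k hl'⟩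
    have hprod : w₁.prod (cyclicEquiv (elV A₀) (elU A₀) (orderOf_elU_eq_elV A₀).symm) =
        w₂.prod _ := by
      change shift k (HNNExtension.of g₀ * (List.map
        (fun x => t A₀ ^ (x.1 : ℤ) * HNNExtension.of x.2) ((ε, g) :: l)).prod) =
        HNNExtension.of g₀ * (List.map
        (fun x => t A₀ ^ (x.1 : ℤ) * HNNExtension.of x.2) ((ε, g) :: l)).prod at h
      rw [map_mul, shift_of, shift_wordProd, mul_right_inj] at h
      simp only [List.map_cons, List.prod_cons, mul_assoc, mul_right_inj] at h
      exact h.symm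
    obtain ⟨-, h2⟩ := HNNExtension.ReducedWord.map_fst_eq_and_of_prod_eq _ hprod
    cases l with
    | nil =>
      have h3 : (HNNExtension.of g : GroupF A₀) =
          HNNExtension.of (shiftFactor A₀ k ε * g) := by
        simpa [w₁, w₂, HNNExtension.NormalWord.ReducedWord.prod] using hprod
      have h4 := HNNExtension.of_injective _ h3
      exact shiftFactor_ne_one hk ε (by simpa using h4)
    | cons b l =>
      -- Comparing the initial entries of the reduced words puts g⁻¹ c g in an associated subgroup.
      -- The conclusion on g would make t^ε g t^δ a pinch, against reducedness.
      obtain ⟨hne, hmem⟩ := conj_shiftFactor_mem hk (h2 b.1 (by simp [w₁]))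
      exact hne ((List.isChain_cons.1 hl).1 b (by simp) hmem)

end Counterexample

/-! ### Closures under isomorphisms of structures. -/

section Transport

variable {L : FirstOrder.Language.{u, v}} {M : Type w} [L.Structure M] {A : Set M}

theorem exists_formula_iff_of_withConstants (φ : L[[A]].Formula Unit) :
    ∃ ψ : L.Formula (A ⊕ Unit), ∀ x : M,
      φ.Realize (fun _ => x) ↔ ψ.Realize (Sum.elim (fun a : A => (a : M)) fun _ => x) :=
  ⟨FirstOrder.Language.BoundedFormula.constantsVarsEquiv φ, fun _ =>
    FirstOrder.Language.BoundedFormula.realize_constantsVarsEquiv.symm⟩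

theorem exists_withConstants_iff_of_formula (ψ : L.Formula (A ⊕ Unit)) :
    ∃ φ : L[[A]].Formula Unit, ∀ x : M,
      φ.Realize (fun _ => x) ↔ ψ.Realize (Sum.elim (fun a : A => (a : M)) fun _ => x) := by
  refine ⟨FirstOrder.Language.BoundedFormula.constantsVarsEquiv.symm ψ, fun x => ?_⟩
  have := FirstOrder.Language.BoundedFormula.realize_constantsVarsEquiv (L := L)
    (φ := FirstOrder.Language.BoundedFormula.constantsVarsEquiv.symm ψ)
    (v := fun _ : Unit => x) (xs := default)
  rw [Equiv.apply_symm_apply] at this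
  exact this.symm

theorem exists_formula_image {N : Type*} [L.Structure N] (e : M ≃[L] N)
    (φ : L[[A]].Formula Unit) : ∃ φ' : L[[(e '' A : Set N)]].Formula Unit,
      ∀ x, φ'.Realize (fun _ => e x) ↔ φ.Realize (fun _ => x) := by
  obtain ⟨ψ, hψ⟩ := exists_formula_iff_of_withConstants φ
  obtain ⟨φ', hφ'⟩ := exists_withConstants_iff_of_formula (M := N) (A := e '' A)
    (ψ.relabel (Sum.map (fun a : A => (⟨e a, a, a.2, rfl⟩ : (e '' A : Set N))) id))
  refine ⟨φ', fun x => ?_⟩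
  rw [hφ', hψ, FirstOrder.Language.Formula.realize_relabel,
    ← FirstOrder.Language.StrongHomClass.realize_formula e ψ]
  apply iff_of_eq
  congr 1
  ext (a | a) <;> rfl

theorem realize_iff_of_fix (e : M ≃[L] M) (he : ∀ a ∈ A, e a = a) (φ : L[[A]].Formula Unit)
    (x : M) : φ.Realize (fun _ => e x) ↔ φ.Realize (fun _ => x) := by
  obtain ⟨ψ, hψ⟩ := exists_formula_iff_of_withConstants φ
  rw [hψ, hψ, ← FirstOrder.Language.StrongHomClass.realize_formula e ψ
    (v := Sum.elim (fun a : A => (a : M)) fun _ => x)]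
  apply iff_of_eq
  congr 1
  ext (a | a)
  · exact (he a a.2).symm
  · rfl

theorem image_acl_subset {N : Type*} [L.Structure N] (e : M ≃[L] N) (A : Set M) :
    e '' acl L A ⊆ acl L (e '' A) := by
  rintro _ ⟨x, ⟨φ, h₁, h₂⟩, rfl⟩
  obtain ⟨φ', hφ'⟩ := exists_formula_image e φ
  refine ⟨φ', (hφ' x).2 h₁, (h₂.image e).subset ?_⟩
  intro z hz
  obtain ⟨z, rfl⟩ := e.surjective z
  exact ⟨z, (hφ' z).1 hz, rfl⟩

theorem image_dcl_subset {N : Type*} [L.Structure N] (e : M ≃[L] N) (A : Set M) :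
    e '' dcl L A ⊆ dcl L (e '' A) := by
  rintro _ ⟨x, ⟨φ, h⟩, rfl⟩
  obtain ⟨φ', hφ'⟩ := exists_formula_image e φ
  refine ⟨φ', ?_⟩
  ext z
  obtain ⟨z, rfl⟩ := e.surjective z
  have h1 : φ.Realize (fun _ => z) ↔ z = x := Set.ext_iff.1 h z
  simpa [hφ'] using h1

theorem symm_image_image {N : Type*} [L.Structure N] (e : M ≃[L] N) (A : Set M) :
    e.symm '' (e '' A) = A := by
  rw [Set.image_image]
  simp

theorem acl_image {N : Type*} [L.Structure N] (e : M ≃[L] N) (A : Set M) :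
    acl L (e '' A) = e '' acl L A := by
  refine (Set.Subset.antisymm (image_acl_subset e A) fun x hx => ?_).symm
  have := image_acl_subset e.symm (e '' A) ⟨x, hx, rfl⟩
  rw [symm_image_image] at this
  exact ⟨_, this, e.apply_symm_apply x⟩

theorem dcl_image {N : Type*} [L.Structure N] (e : M ≃[L] N) (A : Set M) :
    dcl L (e '' A) = e '' dcl L A := by
  refine (Set.Subset.antisymm (image_dcl_subset e A) fun x hx => ?_).symm
  have := image_dcl_subset e.symm (e '' A) ⟨x, hx, rfl⟩
  rw [symm_image_image] at this
  exact ⟨_, this, e.apply_symm_apply x⟩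

theorem aclEx_subset_acl : aclEx L A ⊆ acl L A := fun _ ⟨φ, _, h⟩ => ⟨φ, h⟩

theorem dclEx_subset_dcl : dclEx L A ⊆ dcl L A := fun _ ⟨φ, _, h⟩ => ⟨φ, h⟩

theorem dcl_subset_acl : dcl L A ⊆ acl L A := by
  rintro x ⟨φ, h⟩
  refine ⟨φ, ?_, h ▸ Set.finite_singleton x⟩
  have : x ∈ {z : M | φ.Realize (fun _ => z)} := h ▸ rfl
  exact this

theorem subset_dclEx : A ⊆ dclEx L A := by
  intro x hx
  refine ⟨((FirstOrder.Language.Term.var (Sum.inl ())).bdEqual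
    (L.con (⟨x, hx⟩ : A)).term : L[[A]].BoundedFormula Unit 0), ?_, ?_⟩
  · exact (FirstOrder.Language.BoundedFormula.IsAtomic.equal _ _).isExistential
  · ext z
    simp [FirstOrder.Language.Formula.Realize]

/-- An element of the algebraic closure has a finite orbit under the automorphisms over `A`. -/
theorem finite_orbit_of_mem_acl {x : M} (hx : x ∈ acl L A) :
    {z : M | ∃ e : M ≃[L] M, (∀ a ∈ A, e a = a) ∧ e x = z}.Finite := by
  obtain ⟨φ, h₁, h₂⟩ := hx
  refine h₂.subset ?_
  rintro _ ⟨e, he, rfl⟩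
  exact (realize_iff_of_fix e he φ x).2 h₁

/-- An element of the definable closure is fixed by the automorphisms over `A`. -/
theorem eq_of_mem_dcl {x : M} (hx : x ∈ dcl L A) (e : M ≃[L] M) (he : ∀ a ∈ A, e a = a) :
    e x = x := by
  obtain ⟨φ, h⟩ := hx
  have h1 : ∀ z, φ.Realize (fun _ => z) ↔ z = x := Set.ext_iff.1 h
  rw [← h1, realize_iff_of_fix e he, h1]

end Transport

/-! ### Terms in the language of groups. -/

section GroupLanguage

variable {G : Type w} [Group G]

/-- A group isomorphism is an isomorphism of structures for the language of groups. -/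
def MulEquiv.toGroupLanguageEquiv {G' : Type*} [Group G'] (e : G ≃* G') :
    G ≃[groupLanguage] G' where
  __ := e.toEquiv
  map_fun' {n} f x := by
    cases f
    · exact e.map_mul _ _
    · exact e.map_inv _
    · exact e.map_one
  map_rel' r := r.elim

/-- The symbol of multiplication. -/
def mulSymbol : groupLanguage.Functions 2 := GroupFunc.mul

/-- The symbol of inversion. -/
def invSymbol : groupLanguage.Functions 1 := GroupFunc.inv

variable {A : Set G} {β : Type*}

/-- The product of two terms. -/
def mulTerm (s r : groupLanguage[[A]].Term β) : groupLanguage[[A]].Term β :=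
  FirstOrder.Language.Functions.apply₂
    ((groupLanguage.lhomWithConstants A).onFunction mulSymbol) s r

/-- The inverse of a term. -/
def invTerm (s : groupLanguage[[A]].Term β) : groupLanguage[[A]].Term β :=
  FirstOrder.Language.Functions.apply₁ ((groupLanguage.lhomWithConstants A).onFunction invSymbol) s

@[simp]
theorem realize_mulTerm (s r : groupLanguage[[A]].Term β) (z : β → G) :
    (mulTerm s r).realize z = s.realize z * r.realize z := by
  rw [mulTerm, FirstOrder.Language.Term.realize_functions_apply₂,
    FirstOrder.Language.LHom.map_onFunction]
  rfl

@[simp]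
theorem realize_invTerm (s : groupLanguage[[A]].Term β) (z : β → G) :
    (invTerm s).realize z = (s.realize z)⁻¹ := by
  rw [invTerm, FirstOrder.Language.Term.realize_functions_apply₁,
    FirstOrder.Language.LHom.map_onFunction]
  rfl

/-- The element `a w b w a w⁻¹ b w⁻¹` as a term. -/
def twistTerm (a b w : groupLanguage[[A]].Term β) : groupLanguage[[A]].Term β :=
  mulTerm (mulTerm (mulTerm (mulTerm (mulTerm (mulTerm (mulTerm a w) b) w) a) (invTerm w)) b)
    (invTerm w)

@[simp]
theorem realize_twistTerm (a b w : groupLanguage[[A]].Term β) (z : β → G) :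
    (twistTerm a b w).realize z = twist (a.realize z) (b.realize z) (w.realize z) := by
  simp [twistTerm, twist]

end GroupLanguage

/-! ### The closures of A in F. -/

namespace Counterexample

variable {A₀ : Type u}

/-- A finite orbit under all `shift k` gives a nonzero k with x fixed by `shift k`. -/
theorem acl_subset_subH :
    acl groupLanguage (subA A₀ : Set (GroupF A₀)) ⊆ subH A₀ := by
  intro x hx
  have hfin : (Set.range fun k : ℤ => shift k x).Finite :=
    (finite_orbit_of_mem_acl hx).subset (by
    rintro _ ⟨k, rfl⟩
    refine ⟨(shiftEquiv k).toGroupLanguageEquiv, ?_, rfl⟩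
    rintro _ ⟨a, rfl⟩
    exact shift_ofA k a)
  have hinj : ¬ Function.Injective fun k : ℤ => shift k x := fun h =>
    Set.infinite_range_of_injective h hfin
  simp only [Function.Injective, not_forall] at hinj
  obtain ⟨j, k, hjk, hne⟩ := hinj
  refine mem_subH_of_shift_eq (k := -j + k) (by omega) ?_
  have h1 := congrArg (shift (-j)) hjk
  simp only [shift_shift, neg_add_cancel, shift_zero] at h1
  exact h1.symm

theorem dcl_subset_subA :
    dcl groupLanguage (subA A₀ : Set (GroupF A₀)) ⊆ subA A₀ := fun x hx =>
  mem_subA_of_flip_eq (acl_subset_subH (dcl_subset_acl hx))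
    (eq_of_mem_dcl hx flipEquiv.toGroupLanguageEquiv (by rintro _ ⟨a, rfl⟩; exact flip_ofA a))

/-- The elements of `H` are the values at `y` of terms with parameters in `A`. -/
theorem exists_term {x : GroupF A₀} (hx : x ∈ subH A₀) :
    ∃ T : groupLanguage[[(subA A₀ : Set (GroupF A₀))]].Term (Unit ⊕ Fin 2),
      ∀ f : GroupF A₀ →* GroupF A₀, (∀ a ∈ subA A₀, f a = a) →
        ∀ z : Unit ⊕ Fin 2 → GroupF A₀, z (Sum.inr 0) = f (y A₀) → T.realize z = f x := by
  rw [← closure_subA_y] at hx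
  induction hx using Subgroup.closure_induction with
  | mem x hx =>
    rcases hx with hx | rfl
    · exact ⟨(groupLanguage.con (⟨x, hx⟩ : (subA A₀ : Set (GroupF A₀)))).term, fun f hf z _ => by
        rw [FirstOrder.Language.Term.realize_con]; exact (hf x hx).symm⟩
    · exact ⟨.var (Sum.inr 0), fun f _ z hz => hz⟩
  | one =>
    exact ⟨(groupLanguage.con (⟨1, one_mem _⟩ : (subA A₀ : Set (GroupF A₀)))).term,
      fun f hf z _ => by rw [FirstOrder.Language.Term.realize_con, map_one]⟩
  | mul x x' _ _ h h' =>
    obtain ⟨T, hT⟩ := h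
    obtain ⟨T', hT'⟩ := h'
    exact ⟨mulTerm T T', fun f hf z hz => by
      rw [realize_mulTerm, hT f hf z hz, hT' f hf z hz, map_mul]⟩
  | inv x _ h =>
    obtain ⟨T, hT⟩ := h
    exact ⟨invTerm T, fun f hf z hz => by rw [realize_invTerm, hT f hf z hz, map_inv]⟩

theorem subH_subset_aclEx :
    (subH A₀ : Set (GroupF A₀)) ⊆ aclEx groupLanguage (subA A₀ : Set (GroupF A₀)) := by
  intro x hx
  obtain ⟨T, hT⟩ := exists_term hx
  let c (g : Gen A₀) : groupLanguage[[(subA A₀ : Set (GroupF A₀))]].Term (Unit ⊕ Fin 2) :=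
    (groupLanguage.con (⟨ofA A₀ (.of g), ofA_mem_subA A₀ _⟩ : (subA A₀ : Set (GroupF A₀)))).term
  have hc : ∀ g z, (c g).realize z = ofA A₀ (.of g) := fun g z => rfl
  -- `Sum.inl ()` is the free variable z; the indices 0 and 1 of `Fin 2` are the bound variables w
  -- and s.
  let w : groupLanguage[[(subA A₀ : Set (GroupF A₀))]].Term (Unit ⊕ Fin 2) := .var (Sum.inr 0)
  let s : groupLanguage[[(subA A₀ : Set (GroupF A₀))]].Term (Unit ⊕ Fin 2) := .var (Sum.inr 1)
  let rel := (mulTerm (mulTerm (invTerm s) (c .u)) s).bdEqual (twistTerm (c .a) (c .b) w)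
  let val := (FirstOrder.Language.Term.var (Sum.inl ())).bdEqual T
  have hreal : ∀ z : GroupF A₀, (rel ⊓ val).ex.ex.Realize (fun _ => z) default ↔
      ∃ w s, s⁻¹ * ofA A₀ (.of .u) * s = twistF w ∧ z =
        T.realize (Sum.elim (fun _ => z) (Fin.snoc (Fin.snoc default w) s)) := by
    intro z
    simp only [FirstOrder.Language.BoundedFormula.realize_ex,
      FirstOrder.Language.BoundedFormula.realize_inf, rel, val,
      FirstOrder.Language.BoundedFormula.realize_bdEqual, realize_mulTerm, realize_invTerm,
      realize_twistTerm, hc]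
    rfl
  refine ⟨(rel ⊓ val).ex.ex, ?_, ?_, ?_⟩
  · exact .ex (.ex (FirstOrder.Language.BoundedFormula.IsQF.isExistential (.inf
      (FirstOrder.Language.BoundedFormula.IsAtomic.equal _ _).isQF
      (FirstOrder.Language.BoundedFormula.IsAtomic.equal _ _).isQF)))
  · refine (hreal x).2 ⟨y A₀, t A₀, t_rel, ?_⟩
    exact (hT (MonoidHom.id _) (fun _ _ => rfl) _ rfl).symm
  · refine (Set.toFinite {x, flip x}).subset ?_
    intro z hz
    obtain ⟨w, s, hrel, hz⟩ := (hreal z).1 hz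
    have hf : ∀ a ∈ subA A₀, lift (ofA A₀) w s hrel a = a := by
      rintro _ ⟨a, rfl⟩
      exact lift_ofA _ _ _ hrel a
    rw [hT (lift (ofA A₀) w s hrel) hf _ (lift_y _ _ _ hrel).symm] at hz
    rcases eq_or_eq_inv_of_rel hrel with hw | hw
    · left
      rw [hz]
      exact hom_ext_H (f := lift (ofA A₀) w s hrel) (g := MonoidHom.id _)
        (fun a => lift_ofA _ _ _ hrel a) (by simp [hw]) hx
    · right
      rw [hz]
      exact hom_ext_H (f := lift (ofA A₀) w s hrel) (g := flip)
        (fun a => (lift_ofA _ _ _ hrel a).trans (flip_ofA a).symm) (by simp [hw]) hx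

theorem aclEx_eq : aclEx groupLanguage (subA A₀ : Set (GroupF A₀)) = subH A₀ :=
  Set.Subset.antisymm (aclEx_subset_acl.trans acl_subset_subH) subH_subset_aclEx

theorem acl_eq : acl groupLanguage (subA A₀ : Set (GroupF A₀)) = subH A₀ :=
  Set.Subset.antisymm acl_subset_subH (subH_subset_aclEx.trans aclEx_subset_acl)

theorem dclEx_eq : dclEx groupLanguage (subA A₀ : Set (GroupF A₀)) = subA A₀ :=
  Set.Subset.antisymm (dclEx_subset_dcl.trans dcl_subset_subA) subset_dclEx

theorem dcl_eq : dcl groupLanguage (subA A₀ : Set (GroupF A₀)) = subA A₀ :=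
  Set.Subset.antisymm dcl_subset_subA (subset_dclEx.trans dclEx_subset_dcl)

theorem y_notMem_subA : y A₀ ∉ subA A₀ := by
  rintro ⟨a, ha⟩
  have h1 : flip (y A₀) = y A₀ := by rw [← ha]; exact flip_ofA a
  rw [flip_y, inv_eq_self] at h1
  have h2 := equivFree_y A₀
  rw [h1, map_one] at h2
  exact FreeGroup.one_ne_of _ h2

theorem subA_lt_subH : subA A₀ < subH A₀ := by
  have hy : y A₀ ∈ subH A₀ := ⟨elY A₀, rfl⟩
  refine lt_of_le_of_ne ?_ fun h => y_notMem_subA (h ▸ hy)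
  rintro _ ⟨a, rfl⟩
  exact ⟨_, rfl⟩

end Counterexample

/-- HNN-extensions along corresponding elements of isomorphic groups are isomorphic. -/
noncomputable def CyclicHNN.congr {G G' : Type*} [Group G] [Group G'] (j : G ≃* G') {u v : G}
    {u' v' : G'} (h : orderOf u = orderOf v) (h' : orderOf u' = orderOf v') (hu : j u = u')
    (hv : j v = v') : CyclicHNN u v h ≃* CyclicHNN u' v' h' :=
  MonoidHom.toMulEquiv
    (CyclicHNN.lift (HNNExtension.of.comp j.toMonoidHom) HNNExtension.t (by
      simpa [hu, hv] using CyclicHNN.rel u' v' h'))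
    (CyclicHNN.lift (HNNExtension.of.comp j.symm.toMonoidHom) HNNExtension.t (by
      simpa [← hu, ← hv] using CyclicHNN.rel u v h))
    (HNNExtension.hom_ext (MonoidHom.ext fun x => by simp) (by simp))
    (HNNExtension.hom_ext (MonoidHom.ext fun x => by simp) (by simp))

@[simp]
theorem CyclicHNN.congr_of {G G' : Type*} [Group G] [Group G'] (j : G ≃* G') {u v : G}
    {u' v' : G'} (h : orderOf u = orderOf v) (h' : orderOf u' = orderOf v') (hu : j u = u')
    (hv : j v = v') (x : G) :
    CyclicHNN.congr j h h' hu hv (HNNExtension.of x) = HNNExtension.of (j x) := by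
  simp [CyclicHNN.congr]

/-! ### Arbitrary free groups of finite rank at least four. -/

namespace Counterexample

theorem exists_hnn_of_mulEquiv {A₀ : Type u} {Γ : Type v} [Group Γ] (e : GroupF A₀ ≃* Γ) :
    ∃ (H : Subgroup Γ) (p q : H) (h : orderOf p = orderOf q) (e : CyclicHNN p q h ≃* Γ),
      (∀ x : H, e (HNNExtension.of x) = x) ∧
      ∃ A : Subgroup Γ, A < H ∧
        acl groupLanguage (A : Set Γ) = H ∧ dcl groupLanguage (A : Set Γ) = A ∧
        acl groupLanguage (A : Set Γ) ≠ dcl groupLanguage (A : Set Γ) := by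
  let i : GroupH A₀ →* Γ := e.toMonoidHom.comp HNNExtension.of
  have hi : Function.Injective i := e.injective.comp (HNNExtension.of_injective _)
  have hH : (subH A₀).map e.toMonoidHom = i.range := (MonoidHom.range_comp _ _).symm
  let j : GroupH A₀ ≃* i.range := MonoidHom.ofInjective hi
  have h : orderOf (j (elU A₀)) = orderOf (j (elV A₀)) := by
    rw [MulEquiv.orderOf_eq, MulEquiv.orderOf_eq, orderOf_elU_eq_elV]
  have hlt : (subA A₀).map e.toMonoidHom < i.range := by
    rw [← hH]
    exact (Subgroup.map_lt_map_iff_of_injective e.injective).2 subA_lt_subH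
  have hcoe : ∀ K : Subgroup (GroupF A₀), ((K.map e.toMonoidHom : Subgroup Γ) : Set Γ) =
    e.toGroupLanguageEquiv '' (K : Set (GroupF A₀)) := fun K => rfl
  have hacl : acl groupLanguage (((subA A₀).map e.toMonoidHom : Subgroup Γ) : Set Γ) =
      (i.range : Set Γ) := by
    rw [hcoe, acl_image, acl_eq, ← hcoe, hH]
  have hdcl : dcl groupLanguage (((subA A₀).map e.toMonoidHom : Subgroup Γ) : Set Γ) =
      ((subA A₀).map e.toMonoidHom : Subgroup Γ) := by
    rw [hcoe, dcl_image, dcl_eq]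
  refine ⟨i.range, j (elU A₀), j (elV A₀), h,
    (CyclicHNN.congr j (orderOf_elU_eq_elV A₀) h rfl rfl).symm.trans e, fun x => ?_,
    (subA A₀).map e.toMonoidHom, hlt, hacl, hdcl, ?_⟩
  · obtain ⟨x, rfl⟩ := j.surjective x
    have h1 : (CyclicHNN.congr j (orderOf_elU_eq_elV A₀) h rfl rfl).symm (HNNExtension.of (j x)) =
        HNNExtension.of x := by
      rw [MulEquiv.symm_apply_eq, CyclicHNN.congr_of]
    rw [MulEquiv.trans_apply, h1]
    rfl
  · rw [hacl, hdcl]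
    exact fun h => hlt.ne (SetLike.coe_injective h).symm

end Counterexample

theorem mainTheorem4 :
    (∀ (A₀ : Type u) [Finite A₀],
      Nonempty (FreeGroupBasis (Fin (Nat.card A₀ + 4)) (Counterexample.GroupF A₀)) ∧
      (∀ f : Counterexample.GroupF A₀ →* Counterexample.GroupF A₀,
        (∀ x ∈ Counterexample.subA A₀, f x = x) →
          Function.Bijective f ∧
          ((∀ x ∈ Counterexample.subH A₀, f x = x) ∨
            f (Counterexample.y A₀) = (Counterexample.y A₀)⁻¹)) ∧
      acl groupLanguage (Counterexample.subA A₀ : Set (Counterexample.GroupF A₀)) =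
        Counterexample.subH A₀ ∧
      aclEx groupLanguage (Counterexample.subA A₀ : Set (Counterexample.GroupF A₀)) =
        Counterexample.subH A₀ ∧
      dcl groupLanguage (Counterexample.subA A₀ : Set (Counterexample.GroupF A₀)) =
        Counterexample.subA A₀ ∧
      dclEx groupLanguage (Counterexample.subA A₀ : Set (Counterexample.GroupF A₀)) =
        Counterexample.subA A₀) ∧
    (∀ (n : ℕ), 4 ≤ n → ∀ (Γ : Type v) [Group Γ], Nonempty (FreeGroupBasis (Fin n) Γ) →
      ∃ (H : Subgroup Γ) (p q : H) (h : orderOf p = orderOf q) (e : CyclicHNN p q h ≃* Γ),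
        (∀ x : H, e (HNNExtension.of x) = x) ∧
        ∃ A : Subgroup Γ, A < H ∧
          acl groupLanguage (A : Set Γ) = H ∧ dcl groupLanguage (A : Set Γ) = A ∧
          acl groupLanguage (A : Set Γ) ≠ dcl groupLanguage (A : Set Γ)) := by
  refine ⟨fun A₀ _ => ⟨Counterexample.nonempty_freeGroupBasis A₀,
    fun f hf => Counterexample.bijective_of_fix hf, Counterexample.acl_eq,
    Counterexample.aclEx_eq, Counterexample.dcl_eq, Counterexample.dclEx_eq⟩, ?_⟩
  rintro n hn Γ _ ⟨b⟩
  -- The letters a, b, y, t account for four of the n generators, so A₀ has n − 4 elements.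
  obtain ⟨b'⟩ := Counterexample.nonempty_freeGroupBasis (Fin (n - 4))
  have hcard : Nat.card (Fin (n - 4)) + 4 = n := by rw [Nat.card_fin]; omega
  exact Counterexample.exists_hnn_of_mulEquiv
    ((b'.reindex (finCongr hcard)).repr.trans b.repr.symm)
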